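/- Let $K$ be a field and let $K_0(\mathcal V_K)$ be the Grothendieck ring of varieties over $K$ (reduced separated $K$-schemes of finite type), generated by isomorphism classes $[X]$ with the relations $[X]=[Y]+[X\smallsetminus Y]$ for $Y\subset X$ closed and $[X\times Y]=[X][Y]$. For a finite connected graph $G$ (loops and multiple edges allowed) with $n$ edges numbered $1,\dots,n$, let $$\Psi_G(t_1,\dots,t_n)=\sum_{T}\ \prod_{e\notin E(T)} t_e ,$$ the sum being over the spanning trees $T$ of $G$, and let $X_G=\{t\in\mathbb P^{n-1}_K : \Psi_G(t)=0\}$ be its graph hypersurface. Let $\Sigma_n=\{t\in \mathbb P^{n-1}_K : \prod_{i} t_i=0\}$ be the union of the coordinate hyperplanes. All these closed subsets carry their reduced structure. Let $\Gamma$ be a connected planar graph with $n=\#E(\Gamma)$ edges, and let $\Gamma^\vee$ be a dual graph of $\Gamma$: for some embedding of $\Gamma$ in the sphere $S^2$, the vertices of $\Gamma^\vee$ are the connected components of $S^2\smallsetminus\Gamma$, and $\Gamma^\vee$ has one edge for each edge $e$ of $\Gamma$, which joins the two components that have $e$ in their boundary (a loop if there is only one such component). Then in $K_0(\mathcal V_K)$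 $$[X_\Gamma]-[X_{\Gamma^\vee}]=[\Sigma_n\cap X_\Gamma]-[\Sigma_n\cap X_{\Gamma^\vee}].$$ -/

import Mathlib

universe u

/-!
### Finite multigraphs: connectedness, cycles, spanning trees
-/

namespace Graph

variable {α β α' β' : Type*}

/-- A multigraph is connected if it has a vertex and any two vertices are joined by a walk. -/
def IsConnected (G : Graph α β) : Prop :=
  G.vertexSet.Nonempty ∧ ∀ x ∈ G.vertexSet, ∀ y ∈ G.vertexSet, Relation.ReflTransGen G.Adj x y

/-- `v 0, e 0, v 1, e 1, …, v k, e k` is a cycle of length `k + 1` (indices are cyclic, so `e k`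
leads back to `v 0`): distinct vertices and distinct edges, the edge `e i` joining `v i` to
`v (i + 1)`. A loop is a cycle of length one, two parallel edges form a cycle of length two. -/
def IsCycle (G : Graph α β) {k : ℕ} (v : Fin (k + 1) → α) (e : Fin (k + 1) → β) : Prop :=
  Function.Injective v ∧ Function.Injective e ∧ ∀ i, G.IsLink (e i) (v i) (v (i + 1))

/-- A tree is a connected multigraph without cycles. -/
def IsTree (G : Graph α β) : Prop :=
  G.IsConnected ∧ ∀ (k : ℕ) (v : Fin (k + 1) → α) (e : Fin (k + 1) → β), ¬ G.IsCycle v e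

/-- The set of edges `T` is the edge set of a spanning tree of `G`. -/
def IsSpanningTree (G : Graph α β) (T : Set β) : Prop :=
  T ⊆ G.edgeSet ∧ (G.restrict T).IsTree

/-!
### Embeddings in the sphere and dual graphs
-/

/-- The two-dimensional sphere, as the unit sphere of Euclidean three-space. -/
abbrev TwoSphere : Type := Metric.sphere (0 : EuclideanSpace ℝ (Fin 3)) 1

/-- An embedding of a multigraph in the sphere: vertices go to distinct points, an edge goes to a
path between the images of its ends; the paths are injective except that the two end points of a
loop coincide, and the interior of a path meets neither vertices nor other paths. (The values of
`point` and `arc` outside the vertex set and the edge set are irrelevant.) -/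
structure SphereEmbedding (G : Graph α β) where
  /-- The image of a vertex. -/
  point : α → TwoSphere
  /-- The path that represents an edge. -/
  arc : β → C(unitInterval, TwoSphere)
  point_injOn : Set.InjOn point G.vertexSet
  arc_ends : ∀ e ∈ G.edgeSet, ∃ x y, G.IsLink e x y ∧ arc e 0 = point x ∧ arc e 1 = point y
  arc_injOn : ∀ e ∈ G.edgeSet, Set.InjOn (arc e) (Set.Ioo 0 1)
  arc_ne_point : ∀ e ∈ G.edgeSet, ∀ t ∈ Set.Ioo (0 : unitInterval) 1,
    ∀ x ∈ G.vertexSet, arc e t ≠ point x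
  arc_disjoint : ∀ e ∈ G.edgeSet, ∀ e' ∈ G.edgeSet, e ≠ e' →
    Disjoint (arc e '' Set.Ioo 0 1) (arc e' '' Set.Ioo 0 1)

namespace SphereEmbedding

variable {G : Graph α β} (f : G.SphereEmbedding)

/-- The subset of the sphere covered by the embedded graph. -/
def support : Set TwoSphere :=
  f.point '' G.vertexSet ∪ ⋃ e ∈ G.edgeSet, Set.range (f.arc e)

/-- The open arc of an edge (the edge without its end points). -/
def openArc (e : β) : Set TwoSphere := f.arc e '' Set.Ioo 0 1

/-- The regions of the embedding: the connected components of the complement of the graph. -/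
def regions : Set (Set TwoSphere) :=
  {F | ∃ p ∈ f.supportᶜ, F = connectedComponentIn f.supportᶜ p}

/-- The multigraph `G'` is the dual graph of `G` with respect to the embedding `f`: its vertices
correspond bijectively to the regions of `f`, its edges correspond bijectively to the edges of
`G`, and the ends of the edge that corresponds to `e` are the regions that have `e` in their
boundary. There are two such regions, or only one, in which case the dual edge is a loop. -/
def IsDual (G' : Graph α' β') : Prop :=
  ∃ (region : α' → Set TwoSphere) (dualEdge : β → β'),
    Set.BijOn region G'.vertexSet f.regions ∧
    Set.BijOn dualEdge G.edgeSet G'.edgeSet ∧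
    ∀ e ∈ G.edgeSet, ∀ x y, G'.IsLink (dualEdge e) x y →
      {F ∈ f.regions | f.openArc e ⊆ frontier F} = {region x, region y}

end SphereEmbedding

open MvPolynomial in
open scoped Classical in
/-- The Kirchhoff polynomial `∑_T ∏_{e ∉ T} t_e` of a multigraph whose edges are numbered by
`ε`; the sum is over the spanning trees `T`, given by the sets of numbers of their edges. -/
noncomputable def kirchhoffPolynomial (K : Type*) [Field K] (G : Graph α β) {n : ℕ}
    (ε : G.edgeSet ≃ Fin n) : MvPolynomial (Fin n) K :=
  ∑ T : Finset (Fin n) with G.IsSpanningTree {e | ∃ h : e ∈ G.edgeSet, ε ⟨e, h⟩ ∈ T},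
    ∏ i ∈ Tᶜ, X i

end Graph

/-!
### Varieties and their Grothendieck ring
-/

open CategoryTheory AlgebraicGeometry in
/-- A variety over the field `K`: a reduced separated scheme of finite type over `K`, not
necessarily irreducible. -/
structure AlgVariety (K : Type u) [Field K] where
  /-- The underlying scheme over `K`. -/
  toOver : Over (Spec (CommRingCat.of K))
  isReduced : IsReduced toOver.left
  isSeparated : IsSeparated toOver.hom
  locallyOfFiniteType : LocallyOfFiniteType toOver.hom
  quasiCompact : QuasiCompact toOver.hom

namespace GrothendieckRing

open CategoryTheory CategoryTheory.Limits AlgebraicGeometry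

variable (K : Type u) [Field K]

/-- The relations of the Grothendieck ring of varieties, as elements of the free commutative ring
on all varieties. The product of two varieties is the fibre product over `K` with its reduced
structure; the latter is described as a variety with a surjective closed immersion into the fibre
product. -/
inductive Relation : FreeCommRing (AlgVariety K) → Prop
  | iso (X Y : AlgVariety K) (f : X.toOver ≅ Y.toOver) :
      Relation (FreeCommRing.of X - FreeCommRing.of Y)
  | scissor (X Y U : AlgVariety K) (i : Y.toOver ⟶ X.toOver) (j : U.toOver ⟶ X.toOver)
      (hi : IsClosedImmersion i.left) (hj : IsOpenImmersion j.left)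
      (hij : Set.range j.left = (Set.range i.left)ᶜ) :
      Relation (FreeCommRing.of X - (FreeCommRing.of Y + FreeCommRing.of U))
  | mul (X Y Z : AlgVariety K)
      (i : Z.toOver ⟶ Over.mk (pullback.fst X.toOver.hom Y.toOver.hom ≫ X.toOver.hom))
      (hi : IsClosedImmersion i.left) (hs : Function.Surjective i.left) :
      Relation (FreeCommRing.of Z - FreeCommRing.of X * FreeCommRing.of Y)
  | one (X : AlgVariety K) (hX : IsIso X.toOver.hom) : Relation (FreeCommRing.of X - 1)

end GrothendieckRing

/-- The Grothendieck ring `K₀(𝒱_K)` of varieties over `K`. -/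
abbrev GrothendieckRing (K : Type u) [Field K] : Type (u + 1) :=
  FreeCommRing (AlgVariety K) ⧸ Ideal.span {r | GrothendieckRing.Relation K r}

/-- The class of a variety in the Grothendieck ring. -/
noncomputable def AlgVariety.cls {K : Type u} [Field K] (X : AlgVariety K) : GrothendieckRing K :=
  Ideal.Quotient.mk _ (FreeCommRing.of X)

/-!
### Projective space and its closed subvarieties
-/

namespace ProjSpace

open CategoryTheory AlgebraicGeometry TopologicalSpace MvPolynomial

attribute [local instance] MvPolynomial.gradedAlgebra

variable (K : Type u) [Field K] (n : ℕ)

/-- The projective space over `K` with the homogeneous coordinates `X i`, `i : Fin n`; its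
dimension is `n - 1`, and it is empty for `n = 0`. -/
noncomputable abbrev space : Scheme.{u} := Proj (homogeneousSubmodule (Fin n) K)

/-- The structure morphism of the projective space. -/
noncomputable def toSpec : space K n ⟶ Spec (CommRingCat.of K) :=
  Proj.toSpecZero (homogeneousSubmodule (Fin n) K) ≫
    Spec.map (CommRingCat.ofHom (algebraMap K (homogeneousSubmodule (Fin n) K 0)))

instance : IsSeparated (toSpec K n) := by
  have : IsSeparated (Proj.toSpecZero (homogeneousSubmodule (Fin n) K)) :=
    Proj.isSeparated _
  unfold toSpec
  infer_instance

instance : Algebra.FiniteType (homogeneousSubmodule (Fin n) K 0) (MvPolynomial (Fin n) K) :=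
  have : IsScalarTower K (homogeneousSubmodule (Fin n) K 0) (MvPolynomial (Fin n) K) :=
    ⟨fun c x y ↦ smul_mul_assoc c (x : MvPolynomial (Fin n) K) y⟩
  Algebra.FiniteType.of_restrictScalars_finiteType K _ _

lemma algebraMap_surjective :
    Function.Surjective (algebraMap K (homogeneousSubmodule (Fin n) K 0)) := by
  rintro ⟨p, hp⟩
  rw [homogeneousSubmodule_zero, Submodule.mem_one] at hp
  obtain ⟨c, rfl⟩ := hp
  exact ⟨c, rfl⟩

instance : IsClosedImmersion
    (Spec.map (CommRingCat.ofHom (algebraMap K (homogeneousSubmodule (Fin n) K 0)))) :=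
  IsClosedImmersion.spec_of_surjective _ (algebraMap_surjective K n)

instance : LocallyOfFiniteType (toSpec K n) := by
  unfold toSpec
  infer_instance

instance : QuasiCompact (toSpec K n) := by
  unfold toSpec
  infer_instance

/-- The closed subset `f = 0` of projective space, for a homogeneous polynomial `f`. -/
def hypersurface (f : MvPolynomial (Fin n) K) : Closeds (space K n) :=
  ⟨ProjectiveSpectrum.zeroLocus (homogeneousSubmodule (Fin n) K) {f},
    ProjectiveSpectrum.isClosed_zeroLocus _ _⟩

lemma isReduced_subscheme {X : Scheme.{u}} (Z : Closeds X) :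
    IsReduced (Scheme.IdealSheafData.vanishingIdeal Z).subscheme := by
  have h (U : X.affineOpens) :
      _root_.IsReduced (Γ(X, U) ⧸ (Scheme.IdealSheafData.vanishingIdeal Z).ideal U) := by
    rw [← Ideal.isRadical_iff_quotient_reduced, Scheme.IdealSheafData.vanishingIdeal_ideal]
    exact PrimeSpectrum.isRadical_vanishingIdeal _
  have h' (U : (Scheme.IdealSheafData.vanishingIdeal Z).subschemeCover.openCover.I₀) :
      IsReduced ((Scheme.IdealSheafData.vanishingIdeal Z).subschemeCover.openCover.X U) :=
    (affine_isReduced_iff _).2 (h U)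
  exact IsReduced.of_openCover _ (Scheme.IdealSheafData.vanishingIdeal Z).subschemeCover.openCover

/-- A closed subset of projective space as a variety over `K`, with its reduced structure. -/
noncomputable def closedSubvariety (Z : Closeds (space K n)) : AlgVariety K where
  toOver := Over.mk ((Scheme.IdealSheafData.vanishingIdeal Z).subschemeι ≫ toSpec K n)
  isReduced := isReduced_subscheme Z
  isSeparated := by dsimp; infer_instance
  locallyOfFiniteType := by dsimp; infer_instance
  quasiCompact := by dsimp; infer_instance

/-- The algebraic simplex, i.e. the union of the coordinate hyperplanes. -/
noncomputable def simplex : Closeds (space K n) := hypersurface K n (∏ i, X i)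

end ProjSpace

namespace Graph

/-- The graph hypersurface, the zero locus of the Kirchhoff polynomial in projective space. -/
noncomputable def hypersurface {α β : Type*} (K : Type u) [Field K] (G : Graph α β) {n : ℕ}
    (ε : G.edgeSet ≃ Fin n) : TopologicalSpace.Closeds (ProjSpace.space K n) :=
  ProjSpace.hypersurface K n (G.kirchhoffPolynomial K ε)

end Graph

/-!
### Continuous logarithms and separation of the plane
-/

open scoped unitInterval

/-! On the torus, where no coordinate vanishes, the Cremona transformation inverts all coordinates
and exchanges the two hypersurfaces. The edges of `Γ` outside a spanning tree are dual to the edges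
of a spanning tree of the dual graph, and every spanning tree of the dual arises once. Hence, up to
the numbering of the edges, the polynomial of the dual graph at `t` is `∏ t_i` times the polynomial
of `Γ` at `t⁻¹`. The parts of the two hypersurfaces in the torus are therefore isomorphic, and the
scissor relation leaves only the parts on the simplex.

The topological work lies in `isTree_dual_iff`. A set of dual edges connects the regions exactly
when the sphere minus the vertices and the remaining edges is connected (`isConnected_compl_part`,
`isConnected_restrict_dual`). So it must be shown that a forest does not separate the sphere,
whereas an edge set containing a cycle does.

Both facts rest on Eilenberg's criterion: a closed set `K` does not separate `p` from `q` iff a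
coordinate with zero `p` and pole `q` has a continuous logarithm on `K`. Logarithms on two closed
sets glue when the intersection is connected, so a forest, built from arcs attached at single
points, carries all logarithms. For a cycle, cut into two arcs with common ends `a` and `b`, a
function with zero `a` and pole `b` has logarithms off each arc. If the complement of the cycle were
connected, they would glue to a logarithm around `a`, which is impossible.

On the algebraic side no common degree of the spanning tree monomials is needed: the component of
degree `d` of one polynomial is matched with the component of degree `n - d` of the other, and a
homogeneous prime contains a polynomial iff it contains its components. -/

/-- The function `f` has a continuous logarithm on the set `s`. -/
def HasLogOn {X : Type*} [TopologicalSpace X] (f : X → ℂ) (s : Set X) : Prop :=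
  ∃ g : X → ℂ, ContinuousOn g s ∧ ∀ x ∈ s, Complex.exp (g x) = f x

namespace HasLogOn

variable {X Y : Type*} [TopologicalSpace X] [TopologicalSpace Y]

lemma mono {f : X → ℂ} {s t : Set X} (h : HasLogOn f t) (hst : s ⊆ t) : HasLogOn f s := by
  obtain ⟨g, hg, hgf⟩ := h
  exact ⟨g, hg.mono hst, fun x hx ↦ hgf x (hst hx)⟩

lemma congr {f f' : X → ℂ} {s : Set X} (h : HasLogOn f s) (hff' : Set.EqOn f f' s) :
    HasLogOn f' s := by
  obtain ⟨g, hg, hgf⟩ := h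
  exact ⟨g, hg, fun x hx ↦ (hgf x hx).trans (hff' hx)⟩

lemma mul {f f' : X → ℂ} {s : Set X} (h : HasLogOn f s) (h' : HasLogOn f' s) :
    HasLogOn (fun x ↦ f x * f' x) s := by
  obtain ⟨g, hg, hgf⟩ := h
  obtain ⟨g', hg', hgf'⟩ := h'
  exact ⟨fun x ↦ g x + g' x, hg.add hg', fun x hx ↦ by rw [Complex.exp_add, hgf x hx, hgf' x hx]⟩

lemma const {c : ℂ} (hc : c ≠ 0) (s : Set X) : HasLogOn (fun _ ↦ c) s :=
  ⟨fun _ ↦ Complex.log c, continuousOn_const, fun _ _ ↦ Complex.exp_log hc⟩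

lemma comp {f : Y → ℂ} {t : Set Y} (h : HasLogOn f t) {φ : X → Y} {s : Set X}
    (hφ : ContinuousOn φ s) (hst : Set.MapsTo φ s t) : HasLogOn (f ∘ φ) s := by
  obtain ⟨g, hg, hgf⟩ := h
  exact ⟨g ∘ φ, hg.comp hφ hst, fun x hx ↦ hgf _ (hst hx)⟩

lemma of_slitPlane {f : X → ℂ} {s : Set X} (hf : ContinuousOn f s)
    (h : ∀ x ∈ s, f x ∈ Complex.slitPlane) : HasLogOn f s :=
  ⟨fun x ↦ Complex.log (f x), hf.clog h, fun x hx ↦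
    Complex.exp_log (Complex.slitPlane_ne_zero (h x hx))⟩

/-- A homotopy in `ℂ ∖ {0}` transports logarithms. -/
lemma of_homotopy {s : Set X} (F : I → X → ℂ)
    (hF : ContinuousOn (fun q : I × X ↦ F q.1 q.2) (Set.univ ×ˢ s))
    (h0 : ∀ t, ∀ x ∈ s, F t x ≠ 0) (h : HasLogOn (F 0) s) : HasLogOn (F 1) s := by
  classical
  obtain ⟨g, hg, hgf⟩ := h
  have hc : Continuous fun q : I × s ↦ F q.1 q.2 :=
    hF.comp_continuous (f := fun q : I × s ↦ ((q.1, (q.2 : X)) : I × X)) (by fun_prop)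
      (fun q ↦ ⟨Set.mem_univ _, q.2.2⟩)
  let H : C(I × s, {z : ℂ // z ≠ 0}) :=
    ⟨fun q ↦ ⟨F q.1 q.2, h0 _ _ q.2.2⟩, hc.subtype_mk _⟩
  let f : C(s, ℂ) := ⟨fun x ↦ g x, continuousOn_iff_continuous_domRestrict.1 hg⟩
  have H0 : ∀ a : s, H (0, a) = ⟨Complex.exp (f a), Complex.exp_ne_zero _⟩ :=
    fun a ↦ Subtype.ext (hgf a a.2).symm
  -- The exponential covers `ℂ ∖ {0}`, so the lift `g` at time 0 extends to a lift of the whole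
  -- homotopy; its value at time 1 is the logarithm sought.
  let L := Complex.isCoveringMap_exp.liftHomotopy H f H0
  have hL := Complex.isCoveringMap_exp.liftHomotopy_lifts H f H0
  refine ⟨fun x ↦ if hx : x ∈ s then L (1, ⟨x, hx⟩) else 0, ?_, fun x hx ↦ ?_⟩
  · rw [continuousOn_iff_continuous_domRestrict]
    have : Continuous fun x : s ↦ L (1, x) := by fun_prop
    convert this using 1
    ext x
    simp
  · simp only [hx, dif_pos]
    exact congrArg Subtype.val (congrFun hL (1, ⟨x, hx⟩))

end HasLogOn

/-- Two continuous logarithms on a preconnected set differ by a constant. -/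
lemma exists_eqOn_add_const_of_exp_eq {X : Type*} [TopologicalSpace X] {s : Set X}
    (hs : IsPreconnected s) {g h : X → ℂ} (hg : ContinuousOn g s) (hh : ContinuousOn h s)
    (hgh : ∀ x ∈ s, Complex.exp (g x) = Complex.exp (h x)) :
    ∃ k : ℂ, Complex.exp k = 1 ∧ ∀ x ∈ s, g x = h x + k := by
  rcases s.eq_empty_or_nonempty with rfl | ⟨a, ha⟩
  · exact ⟨0, by simp, by simp⟩
  · have hk : Complex.exp (g a - h a) = 1 := by
      rw [Complex.exp_sub, hgh a ha, div_self (Complex.exp_ne_zero _)]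
    refine ⟨g a - h a, hk, ?_⟩
    refine Complex.isCoveringMap_exp.eqOn_of_comp_eqOn (g₁ := g) (g₂ := fun x ↦ h x + (g a - h a))
      hs hg (hh.add continuousOn_const) (fun x hx ↦ Subtype.ext ?_) ha (by simp)
    simp only [Function.comp]
    rw [Complex.exp_add, hk, mul_one, hgh x hx]

namespace HasLogOn

variable {X : Type*} [TopologicalSpace X]

-- On the overlap the logarithms differ by a constant, by which one of them can be shifted.
-- Continuity is stated on `A` and `B` separately, because passing to the union needs both sets
-- closed or both open.
open scoped Classical in
lemma exists_glue {f : X → ℂ} {A B : Set X} (hA : HasLogOn f A) (hB : HasLogOn f B)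
    (hAB : IsPreconnected (A ∩ B)) :
    ∃ g : X → ℂ, ContinuousOn g A ∧ ContinuousOn g B ∧
      ∀ x ∈ A ∪ B, Complex.exp (g x) = f x := by
  obtain ⟨g, hg, hgf⟩ := hA
  obtain ⟨h, hh, hhf⟩ := hB
  obtain ⟨k, hk, hgh⟩ := exists_eqOn_add_const_of_exp_eq hAB
    (hg.mono Set.inter_subset_left) (hh.mono Set.inter_subset_right)
    (fun x hx ↦ (hgf x hx.1).trans (hhf x hx.2).symm)
  refine ⟨A.piecewise g fun x ↦ h x + k, ?_, ?_, ?_⟩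
  · exact hg.congr (Set.piecewise_eqOn _ _ _)
  · refine (hh.add (continuousOn_const (c := k))).congr fun x hx ↦ ?_
    by_cases hxA : x ∈ A
    · simp [hxA, hgh x ⟨hxA, hx⟩]
    · simp [hxA]
  · intro x hx
    by_cases hxA : x ∈ A
    · simp [hxA, hgf]
    · simp [hxA, Complex.exp_add, hk, hhf x (hx.resolve_left hxA)]

lemma union_of_isClosed {f : X → ℂ} {A B : Set X} (hA : HasLogOn f A) (hB : HasLogOn f B)
    (hA' : IsClosed A) (hB' : IsClosed B) (hAB : IsPreconnected (A ∩ B)) :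
    HasLogOn f (A ∪ B) := by
  obtain ⟨g, h1, h2, h3⟩ := hA.exists_glue hB hAB
  exact ⟨g, h1.union_of_isClosed h2 hA' hB', h3⟩

lemma union_of_isOpen {f : X → ℂ} {A B : Set X} (hA : HasLogOn f A) (hB : HasLogOn f B)
    (hA' : IsOpen A) (hB' : IsOpen B) (hAB : IsPreconnected (A ∩ B)) :
    HasLogOn f (A ∪ B) := by
  obtain ⟨g, h1, h2, h3⟩ := hA.exists_glue hB hAB
  exact ⟨g, h1.union_of_isOpen h2 hA' hB', h3⟩

end HasLogOn

/-- There is no continuous branch of the logarithm on a circle around the origin. -/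
lemma not_hasLogOn_sphere (p : ℂ) {r : ℝ} (hr : 0 < r) :
    ¬ HasLogOn (fun z : ℂ ↦ z - p) (Metric.sphere p r) := by
  rintro ⟨g, hg, hgf⟩
  let c : ℝ → ℂ := fun θ ↦ p + r * Complex.exp (θ * Complex.I)
  have hc : ∀ θ, c θ ∈ Metric.sphere p r := fun θ ↦ by
    simp [c, Complex.norm_exp_ofReal_mul_I, abs_of_pos hr]
  have hcc : Continuous c := by fun_prop
  have hgc : Continuous fun θ ↦ g (c θ) := hg.comp_continuous hcc hc
  -- Pulled back to the line, `g` differs by a constant from `log r + iθ`; the former is periodic in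
  -- `θ` and the latter is not.
  obtain ⟨k, -, hk⟩ := exists_eqOn_add_const_of_exp_eq (X := ℝ) isPreconnected_univ
    hgc.continuousOn
    (h := fun θ : ℝ ↦ Complex.log r + θ * Complex.I) (by fun_prop)
    (fun θ _ ↦ by
      rw [hgf _ (hc θ), Complex.exp_add, Complex.exp_log (by exact_mod_cast hr.ne')]
      simp [c])
  have h0 := hk 0 (Set.mem_univ _)
  have h1 := hk (2 * Real.pi) (Set.mem_univ _)
  have : c (2 * Real.pi) = c 0 := by simp [c]
  rw [this, h0] at h1
  simp [Real.pi_ne_zero] at h1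

/-- If `p` can be joined in the complement of `K` to a point farther from the origin than all
of `K`, then `z - p` has a continuous logarithm on `K`. -/
lemma HasLogOn.of_joinedIn {K : Set ℂ} {p w : ℂ} (h : JoinedIn Kᶜ p w)
    (hw : ∀ z ∈ K, ‖z‖ < ‖w‖) : HasLogOn (fun z : ℂ ↦ z - p) K := by
  obtain ⟨γ, hγ⟩ := h.symm
  have := HasLogOn.of_homotopy (s := K) (fun t z ↦ z - γ t) (by fun_prop)
    (fun t z hz h ↦ hγ t (by rwa [← sub_eq_zero.1 h])) ?_
  · simpa using this
  rcases K.eq_empty_or_nonempty with rfl | ⟨z₀, hz₀⟩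
  · exact ⟨0, by simp, by simp⟩
  have hw0 : w ≠ 0 := norm_pos_iff.1 ((norm_nonneg z₀).trans_lt (hw z₀ hz₀))
  -- Start of the homotopy, with the zero at `w`: as `w` is farther out than `K`, the factor `1 - z
  -- / w` of `z - w` has positive real part on `K`.
  have h1 : HasLogOn (fun z : ℂ ↦ 1 - z / w) K := by
    refine HasLogOn.of_slitPlane (by fun_prop) fun z hz ↦ Or.inl ?_
    have h2 : ‖z / w‖ < 1 := by
      rw [norm_div, div_lt_one (norm_pos_iff.2 hw0)]
      exact hw z hz
    have h3 := (Complex.re_le_norm (z / w)).trans_lt h2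
    simp only [Complex.sub_re, Complex.one_re]
    linarith
  refine (h1.mul (HasLogOn.const (neg_ne_zero.2 hw0) K)).congr fun z hz ↦ ?_
  simp only [Path.source]
  field_simp
  ring

open Bornology in
/-- If `z - p` has a continuous logarithm on the compact set `K` then the component of `p` in the
complement of `K` is unbounded. -/
lemma HasLogOn.not_isBounded_connectedComponentIn {K : Set ℂ} (hK : IsCompact K) {p : ℂ}
    (hp : p ∉ K) (h : HasLogOn (fun z : ℂ ↦ z - p) K) :
    ¬ IsBounded (connectedComponentIn Kᶜ p) := by
  classical
  intro hb
  set W := connectedComponentIn Kᶜ p with hW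
  have hWo : IsOpen W := hK.isClosed.isOpen_compl.connectedComponentIn
  have hpW : p ∈ W := mem_connectedComponentIn hp
  have hfr : frontier W ⊆ K := by
    intro z hz
    by_contra hzK
    have hzW : z ∈ W := by
      have hpre : IsPreconnected (insert z W) := by
        refine isPreconnected_connectedComponentIn.subset_closure (Set.subset_insert _ _) ?_
        exact Set.insert_subset hz.1 subset_closure
      have : insert z W ⊆ Kᶜ := Set.insert_subset hzK (connectedComponentIn_subset _ _)
      exact hpre.subset_connectedComponentIn (Set.mem_insert_of_mem _ hpW) this
        (Set.mem_insert _ _)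
    rw [hWo.frontier_eq] at hz
    exact hz.2 hzW
  obtain ⟨g, hg, hgf⟩ := h
  -- Tietze's theorem extends the logarithm from `K` to the plane.
  obtain ⟨G, hG⟩ := ContinuousMap.exists_restrict_eq hK.isClosed
    (⟨K.domRestrict g, continuousOn_iff_continuous_domRestrict.1 hg⟩ : C(K, ℂ))
  have hGg : ∀ z ∈ K, G z = g z := fun z hz ↦ congrArg (fun q : C(K, ℂ) ↦ q ⟨z, hz⟩) hG
  -- The two formulas agree on `frontier W ⊆ K`. Replacing `z - p` on `W` removes its only zero, so
  -- `F` has a logarithm on the contractible plane; but on a circle enclosing the bounded set `W` it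
  -- is still `z - p`.
  let F : ℂ → ℂ := W.piecewise (fun z ↦ Complex.exp (G z)) fun z ↦ z - p
  have hF : Continuous F := by
    refine continuous_piecewise (fun z hz ↦ ?_) (by fun_prop) (by fun_prop)
    rw [hGg z (hfr hz), hgf z (hfr hz)]
  have hF0 : ∀ z, F z ≠ 0 := by
    intro z
    by_cases hz : z ∈ W
    · simp [F, hz]
    · simp only [F, Set.piecewise_eq_of_notMem _ _ _ hz]
      exact sub_ne_zero.2 fun h ↦ hz (h ▸ hpW)
  have hlog : HasLogOn F Set.univ := by
    have := HasLogOn.of_homotopy (s := (Set.univ : Set ℂ)) (fun t z ↦ F ((t : ℝ) * z))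
      (by fun_prop) (fun _ _ _ ↦ hF0 _)
      (by simpa using HasLogOn.const (hF0 0) _)
    simpa using this
  obtain ⟨R, hR0, hR⟩ := hb.subset_ball_lt 0 p
  refine not_hasLogOn_sphere p hR0 ((hlog.mono (Set.subset_univ _)).congr fun z hz ↦ ?_)
  have : z ∉ W := fun h ↦ by
    have := hR h
    rw [Metric.mem_ball, Metric.mem_sphere.1 hz] at this
    exact lt_irrefl _ this
  simp [F, this]

lemma isPreconnected_setOf_lt_norm (R : ℝ) (hR : 0 ≤ R) : IsPreconnected {z : ℂ | R < ‖z‖} := by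
  have : {z : ℂ | R < ‖z‖} =
      (fun q : ℝ × ℝ ↦ (q.1 : ℂ) * Complex.exp (q.2 * Complex.I)) ''
        (Set.Ioi R ×ˢ Set.univ) := by
    ext z
    constructor
    · intro hz
      exact ⟨(‖z‖, Complex.arg z), ⟨hz, trivial⟩, Complex.norm_mul_exp_arg_mul_I z⟩
    · rintro ⟨⟨r, θ⟩, ⟨hr, -⟩, rfl⟩
      have hr : R < r := hr
      simpa [Complex.norm_exp_ofReal_mul_I, abs_of_pos (hR.trans_lt hr)] using hr
  rw [this]
  exact (isPreconnected_Ioi.prod isPreconnected_univ).image _ (by fun_prop)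

/-!
### Separation of the sphere
-/

open Graph (TwoSphere)

namespace TwoSphere

instance : Fact (Module.finrank ℝ (EuclideanSpace ℝ (Fin 3)) = 2 + 1) := ⟨by simp⟩

instance : LocallyPathConnectedSpace TwoSphere :=
  ChartedSpace.locallyPathConnectedSpace (EuclideanSpace ℝ (Fin 2)) TwoSphere

/-- The stereographic projection from a point of the sphere, with values in the complex plane. -/
noncomputable def chart (q : TwoSphere) : OpenPartialHomeomorph TwoSphere ℂ :=
  (stereographic' 2 q).trans
    Complex.orthonormalBasisOneI.repr.symm.toHomeomorph.toOpenPartialHomeomorph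

variable {q : TwoSphere}

lemma chart_source (q : TwoSphere) : (chart q).source = {q}ᶜ := by simp [chart]

lemma chart_target (q : TwoSphere) : (chart q).target = Set.univ := by simp [chart]

lemma mem_chart_source {z : TwoSphere} (hz : z ≠ q) : z ∈ (chart q).source := by
  simpa [chart_source] using hz

lemma mem_chart_target (w : ℂ) : w ∈ (chart q).target := by simp [chart_target]

lemma continuousOn_chart (q : TwoSphere) : ContinuousOn (chart q) {q}ᶜ :=
  chart_source q ▸ (chart q).continuousOn

lemma continuous_chart_symm (q : TwoSphere) : Continuous (chart q).symm := by
  rw [← continuousOn_univ, ← chart_target q]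
  exact (chart q).continuousOn_symm

lemma chart_symm_ne (w : ℂ) : (chart q).symm w ≠ q := by
  have := (chart q).map_target (mem_chart_target w)
  simpa [chart_source] using this

lemma chart_chart_symm (w : ℂ) : chart q ((chart q).symm w) = w :=
  (chart q).right_inv (mem_chart_target w)

lemma chart_symm_chart {z : TwoSphere} (hz : z ≠ q) : (chart q).symm (chart q z) = z :=
  (chart q).left_inv (mem_chart_source hz)

lemma chart_injOn (q : TwoSphere) : Set.InjOn (chart q) {q}ᶜ := chart_source q ▸ (chart q).injOn

/-- The chart has a pole at `q`: the points sent into a closed disc form a compact set that misses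
`q`. -/
lemma eventually_lt_norm_chart (q : TwoSphere) (R : ℝ) :
    ∀ᶠ z in nhds q, z ≠ q → R < ‖chart q z‖ := by
  have hc : IsCompact ((chart q).symm '' Metric.closedBall 0 R) :=
    (isCompact_closedBall _ _).image (continuous_chart_symm q)
  have hq : q ∉ (chart q).symm '' Metric.closedBall 0 R := by
    rintro ⟨w, -, hw⟩
    exact chart_symm_ne w hw
  filter_upwards [hc.isClosed.isOpen_compl.mem_nhds hq] with z hz hzq
  by_contra! h
  exact hz ⟨chart q z, by simpa using h, chart_symm_chart hzq⟩

/-- An isolated point would be clopen in the connected sphere. -/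
lemma frequently_ne (q : TwoSphere) : ∃ᶠ z in nhds q, z ≠ q := by
  intro h
  simp only [ne_eq, not_not] at h
  have ho : IsOpen {q} := by
    rw [isOpen_singleton_iff_nhds_eq_pure, le_antisymm_iff]
    exact ⟨Filter.le_pure_iff.2 h, pure_le_nhds q⟩
  have hclopen : IsClopen {q} := ⟨isClosed_singleton, ho⟩
  have hc : IsPreconnected (Set.univ : Set TwoSphere) := by
    have : IsPreconnected (Metric.sphere (0 : EuclideanSpace ℝ (Fin 3)) 1) :=
      isPreconnected_sphere (by simp [← Module.finrank_eq_rank]) _ _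
    have := Subtype.preconnectedSpace this
    exact isPreconnected_univ
  have : PreconnectedSpace TwoSphere := ⟨hc⟩
  rcases isClopen_iff.1 hclopen with h | h
  · simp at h
  · have : (chart q).symm 0 ∈ ({q} : Set TwoSphere) := h ▸ Set.mem_univ _
    exact chart_symm_ne 0 this

/-- If `p` and `q` are not separated by `K`, then a coordinate with zero at `p` and pole at `q`
has a continuous logarithm on `K`. -/
lemma hasLogOn_chart_of_joinedIn {K : Set TwoSphere} (hK : IsClosed K) {p q : TwoSphere}
    (hpq : p ≠ q) (h : JoinedIn Kᶜ p q) : HasLogOn (fun z ↦ chart q z - chart q p) K := by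
  obtain ⟨γ, hγ⟩ := h
  have hqK : q ∉ K := by simpa using hγ 1
  have hKq : K ⊆ {q}ᶜ := fun z hz hzq ↦ hqK (hzq ▸ hz)
  have hcpt : IsCompact (chart q '' K) := hK.isCompact.image_of_continuousOn
    ((continuousOn_chart q).mono hKq)
  obtain ⟨R, hR⟩ := hcpt.isBounded.exists_norm_le
  have hcl : IsClosed {t | γ t = q} := isClosed_eq γ.continuous continuous_const
  -- The path is stopped shortly before its first visit `t₁` to the pole `q`. Up to then it stays in
  -- the chart, and it ends farther from the origin than the image of `K`, as `HasLogOn.of_joinedIn`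
  -- requires.
  obtain ⟨t₁, ht₁, hmin⟩ := hcl.isCompact.exists_isLeast ⟨1, γ.target⟩
  have ht₁0 : 0 < t₁ := by
    refine lt_of_le_of_ne t₁.2.1 fun h ↦ hpq ?_
    have ht₁ : γ t₁ = q := ht₁
    rw [← ht₁, ← h, γ.source]
  have hlt : ∀ t < t₁, γ t ≠ q := fun t ht h ↦ absurd (hmin h) (not_le.2 ht)
  have hev : ∀ᶠ t in nhds t₁, γ t ≠ q → R < ‖chart q (γ t)‖ := by
    have : Filter.Tendsto γ (nhds t₁) (nhds q) := by
      have := γ.continuous.tendsto t₁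
      rwa [show γ t₁ = q from ht₁] at this
    exact this (eventually_lt_norm_chart q R)
  have : (nhdsWithin t₁ (Set.Iio t₁)).NeBot := by
    refine mem_closure_iff_nhdsWithin_neBot.1 ?_
    rw [closure_Iio' (a := t₁) ⟨0, ht₁0⟩]
    exact le_refl t₁
  obtain ⟨t₀, h₀, h₀'⟩ := ((hev.filter_mono nhdsWithin_le_nhds).and
    (self_mem_nhdsWithin (a := t₁) (s := Set.Iio t₁))).exists
  have h₀' : t₀ < t₁ := h₀'
  have hj : JoinedIn (chart q '' K)ᶜ (chart q p) (chart q (γ t₀)) := by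
    have h1 : JoinedIn (γ '' Set.Icc 0 t₀) p (γ t₀) := by
      refine ⟨⟨⟨fun t ↦ γ (t * t₀), by fun_prop⟩, by simp, by simp⟩, fun t ↦ ?_⟩
      exact ⟨t * t₀, ⟨unitInterval.nonneg _, unitInterval.mul_le_right⟩, rfl⟩
    have hsub : γ '' Set.Icc 0 t₀ ⊆ {q}ᶜ := by
      rintro _ ⟨t, ht, rfl⟩
      exact hlt t (ht.2.trans_lt h₀')
    have h3 := h1.map_continuousOn ((continuousOn_chart q).mono hsub)
    refine h3.mono ?_
    rintro _ ⟨_, ⟨t, ht, rfl⟩, rfl⟩ ⟨z, hz, hzt⟩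
    have := chart_injOn q (hKq hz) (hsub ⟨t, ht, rfl⟩) hzt
    exact hγ t (this ▸ hz)
  have := HasLogOn.of_joinedIn hj fun z hz ↦ (hR z hz).trans_lt (h₀ (hlt t₀ h₀'))
  exact this.comp ((continuousOn_chart q).mono hKq) (Set.mapsTo_image _ _)

/-- If a coordinate with zero at `p` and pole at `q` has a continuous logarithm on `K`, then `p`
and `q` are not separated by `K`. -/
lemma mem_connectedComponentIn_of_hasLogOn {K : Set TwoSphere} (hK : IsClosed K)
    {p q : TwoSphere} (hp : p ∉ K) (hq : q ∉ K) (hpq : p ≠ q)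
    (h : HasLogOn (fun z ↦ chart q z - chart q p) K) :
    q ∈ connectedComponentIn Kᶜ p := by
  have hKq : K ⊆ {q}ᶜ := fun z hz hzq ↦ hq (hzq ▸ hz)
  have hcpt : IsCompact (chart q '' K) := hK.isCompact.image_of_continuousOn
    ((continuousOn_chart q).mono hKq)
  have hpK : chart q p ∉ chart q '' K := by
    rintro ⟨z, hz, hzp⟩
    exact hp (chart_injOn q (hKq hz) hpq hzp ▸ hz)
  have hlog : HasLogOn (fun w : ℂ ↦ w - chart q p) (chart q '' K) := by
    refine (h.comp (continuous_chart_symm q).continuousOn ?_).congr fun w _ ↦ ?_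
    · rintro _ ⟨z, hz, rfl⟩
      rwa [chart_symm_chart (hKq hz)]
    · simp [chart_chart_symm]
  have hub := hlog.not_isBounded_connectedComponentIn hcpt hpK
  obtain ⟨R, hR⟩ := hcpt.isBounded.exists_norm_le
  obtain ⟨w, hw, hwR⟩ : ∃ w ∈ connectedComponentIn (chart q '' K)ᶜ (chart q p),
      max R 0 < ‖w‖ := by
    by_contra! hcon
    exact hub ((Metric.isBounded_closedBall (x := (0 : ℂ)) (r := max R 0)).subset
      fun w hw ↦ by simpa using hcon w hw)
  -- `C` contains `p` and, being unbounded in the chart, meets the outside `D` of a disc containing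
  -- the image of `K`. Since `q` lies in the closure of `D`, the set `C ∪ insert q D` connects `p`
  -- to `q` off `K`.
  set C := (chart q).symm '' connectedComponentIn (chart q '' K)ᶜ (chart q p) with hC
  set D := (chart q).symm '' {z : ℂ | max R 0 < ‖z‖} with hD
  have hsymmK : ∀ v, v ∉ chart q '' K → (chart q).symm v ∈ Kᶜ := fun v hv hvK ↦
    hv ⟨_, hvK, chart_chart_symm v⟩
  have hCK : C ⊆ Kᶜ := by
    rintro _ ⟨v, hv, rfl⟩
    exact hsymmK v (connectedComponentIn_subset _ _ hv)
  have hDK : D ⊆ Kᶜ := by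
    rintro _ ⟨v, hv, rfl⟩
    refine hsymmK v fun hvK ↦ ?_
    exact absurd (hR v hvK) (not_le.2 ((le_max_left _ _).trans_lt hv))
  have hCc : IsPreconnected C :=
    isPreconnected_connectedComponentIn.image _ (continuous_chart_symm q).continuousOn
  have hDc : IsPreconnected (insert q D) := by
    refine ((isPreconnected_setOf_lt_norm _ (le_max_right R 0)).image _
      (continuous_chart_symm q).continuousOn).subset_closure (Set.subset_insert _ _) ?_
    refine Set.insert_subset ?_ subset_closure
    rw [mem_closure_iff_frequently]
    refine ((frequently_ne q).and_eventually (eventually_lt_norm_chart q (max R 0))).mono ?_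
    rintro z ⟨hz, hz'⟩
    exact ⟨chart q z, hz' hz, chart_symm_chart hz⟩
  have hu : IsPreconnected (C ∪ insert q D) :=
    hCc.union ((chart q).symm w) ⟨w, hw, rfl⟩ (Set.mem_insert_of_mem _ ⟨w, hwR, rfl⟩) hDc
  refine hu.subset_connectedComponentIn (Or.inl ?_)
    (Set.union_subset hCK (Set.insert_subset hq hDK)) (Or.inr (Set.mem_insert _ _))
  exact ⟨chart q p, mem_connectedComponentIn hpK, chart_symm_chart hpq⟩

/-- Two closed sets that meet in two points, and join these points, together separate the
sphere. -/
theorem not_isConnected_compl_union {A B : Set TwoSphere} (hA : IsClosed A) (hB : IsClosed B)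
    {a b : TwoSphere} (hab : a ≠ b) (hAab : JoinedIn A a b) (hBab : JoinedIn B a b)
    (hAB : A ∩ B ⊆ {a, b}) : ¬ IsConnected (A ∪ B)ᶜ := by
  classical
  rintro ⟨⟨c, hc⟩, hconn⟩
  rw [Set.compl_union] at hc hconn
  have hac : a ≠ c := fun h ↦ hc.1 (h ▸ hAab.source_mem)
  have hbc : b ≠ c := fun h ↦ hc.1 (h ▸ hAab.target_mem)
  -- The value 0 at the pole `c` of the chart makes `h` continuous off `b`. In the chart, with `α`,
  -- `β`, `w` the images of `a`, `b`, `z`, one has `1 + (β - α) * h z = (w - α) / (w - β)`: zero at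
  -- `a`, pole at `b`.
  let h : TwoSphere → ℂ := fun z ↦ if z = c then 0 else (chart c z - chart c b)⁻¹
  have hne : ∀ z, z ≠ c → z ≠ b → chart c z - chart c b ≠ 0 := fun z hz hzb h ↦
    hzb (chart_injOn c hz hbc (sub_eq_zero.1 h))
  have hh : ContinuousOn h {b}ᶜ := by
    intro z hz
    refine ContinuousAt.continuousWithinAt ?_
    by_cases hzc : z = c
    · subst hzc
      rw [Metric.continuousAt_iff']
      intro δ hδ
      filter_upwards [eventually_lt_norm_chart z (δ⁻¹ + ‖chart z b‖)] with y hy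
      by_cases hyz : y = z
      · simpa [hyz] using hδ
      · have h1 : δ⁻¹ < ‖chart z y - chart z b‖ := by
          have := norm_sub_norm_le (chart z y) (chart z b)
          linarith [hy hyz]
        simpa [h, hyz] using inv_lt_of_inv_lt₀ hδ h1
    · have h1 : ContinuousAt (fun z ↦ (chart c z - chart c b)⁻¹) z := by
        refine ContinuousAt.inv₀ ?_ (hne z hzc hz)
        exact (((continuousOn_chart c).continuousAt
          (isOpen_compl_singleton.mem_nhds hzc))).sub continuousAt_const
      refine h1.congr ?_
      filter_upwards [isOpen_compl_singleton.mem_nhds hzc] with y hy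
      simp [h, show y ≠ c from hy]
  -- Moving the zero along a path in `A` from `b`, where it cancels the pole and leaves the constant
  -- 1, to `a` creates no zero off `A`.
  have key : ∀ A : Set TwoSphere, JoinedIn A a b → c ∉ A →
      HasLogOn (fun z ↦ 1 + (chart c b - chart c a) * h z) Aᶜ := by
    rintro A ⟨γ, hγ⟩ hcA
    have hγc : ∀ t, γ t ≠ c := fun t h ↦ hcA (h ▸ hγ t)
    have hbA : b ∈ A := γ.target ▸ hγ 1
    have hγc' : Continuous fun t ↦ chart c (γ t) :=
      (continuousOn_chart c).comp_continuous γ.continuous hγc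
    have := HasLogOn.of_homotopy (s := Aᶜ)
      (fun t z ↦ 1 + (chart c b - chart c (γ.symm t)) * h z) ?_ ?_ ?_
    · simpa using this
    · have h1 : ContinuousOn (fun q : I × TwoSphere ↦ h q.2) (Set.univ ×ˢ Aᶜ) :=
        hh.comp continuousOn_snd fun q hq (hqb : q.2 = b) ↦ hq.2 (hqb.symm ▸ hbA)
      have h2 : Continuous fun t ↦ chart c (γ.symm t) :=
        (continuousOn_chart c).comp_continuous γ.symm.continuous (fun t ↦ hγc _)
      have h3 : Continuous fun q : I × TwoSphere ↦ chart c (γ.symm q.1) := h2.comp continuous_fst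
      exact continuousOn_const.add ((continuousOn_const.sub h3.continuousOn).mul h1)
    · intro t z hz h0
      by_cases hzc : z = c
      · simp [h, hzc] at h0
      · have hzb : z ≠ b := fun h ↦ hz (h ▸ hbA)
        simp only [h, if_neg hzc] at h0
        field_simp [hne z hzc hzb] at h0
        have h1 : chart c z = chart c (γ.symm t) := by linear_combination h0
        have h2 := chart_injOn c hzc (hγc _) h1
        exact hz (h2 ▸ hγ _)
    · simpa using HasLogOn.const one_ne_zero Aᶜ
  -- The overlap `Aᶜ ∩ Bᶜ` is assumed connected, so there is a logarithm off `A ∩ B ⊆ {a, b}`, in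
  -- particular on a circle around `α` leaving `β` outside. There `w - β` has a logarithm too, hence
  -- so would `w - α`.
  have hglue := (key A hAab hc.1).union_of_isOpen (key B hBab hc.2) hA.isOpen_compl
    hB.isOpen_compl hconn
  rw [← Set.compl_inter] at hglue
  set α := chart c a with hα
  set β := chart c b with hβ
  have hαβ : α ≠ β := fun h ↦ hab (chart_injOn c hac hbc h)
  have hd : 0 < ‖α - β‖ := norm_pos_iff.2 (sub_ne_zero.2 hαβ)
  have hr : 0 < ‖α - β‖ / 2 := by positivity
  have hsb : ∀ w ∈ Metric.sphere α (‖α - β‖ / 2), ‖w - α‖ < ‖α - β‖ := by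
    intro w hw
    rw [mem_sphere_iff_norm.1 hw]
    linarith
  have hwβ : ∀ w ∈ Metric.sphere α (‖α - β‖ / 2), w ≠ β := by
    rintro w hw rfl
    have := hsb _ hw
    rw [norm_sub_rev] at this
    exact lt_irrefl _ this
  have hwα : ∀ w ∈ Metric.sphere α (‖α - β‖ / 2), w ≠ α := by
    rintro w hw rfl
    rw [Metric.mem_sphere, dist_self] at hw
    exact hr.ne hw
  have hl1 : HasLogOn (fun w : ℂ ↦ w - β) (Metric.sphere α (‖α - β‖ / 2)) := by
    have h1 : HasLogOn (fun w : ℂ ↦ 1 + (w - α) / (α - β)) (Metric.sphere α (‖α - β‖ / 2)) := by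
      refine HasLogOn.of_slitPlane (by fun_prop) fun z hz ↦ Or.inl ?_
      have h2 : ‖(z - α) / (α - β)‖ < 1 := by
        rw [norm_div, div_lt_one hd]
        exact hsb z hz
      have h3 := (abs_le.1 ((Complex.abs_re_le_norm ((z - α) / (α - β))))).1
      simp only [Complex.add_re, Complex.one_re]
      linarith
    refine (h1.mul (HasLogOn.const (sub_ne_zero.2 hαβ) _)).congr fun z hz ↦ ?_
    have := sub_ne_zero.2 hαβ
    field_simp
    ring
  have hl2 := hglue.comp (φ := (chart c).symm) (s := Metric.sphere α (‖α - β‖ / 2))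
    (continuous_chart_symm c).continuousOn ?_
  · refine not_hasLogOn_sphere α hr ((hl2.mul hl1).congr fun w hw ↦ ?_)
    have := sub_ne_zero.2 (hwβ w hw)
    simp only [Function.comp, h, if_neg (chart_symm_ne w), chart_chart_symm, ← hβ]
    field_simp
    ring
  · intro w hw hwAB
    rcases hAB hwAB with h | h
    · refine hwα w hw ?_
      rw [hα, ← h, chart_chart_symm]
    · refine hwβ w hw ?_
      have h : (chart c).symm w = b := h
      rw [hβ, ← h, chart_chart_symm]

end TwoSphere

/-!
### Spanning trees
-/

namespace Graph

variable {α β : Type*} {G : Graph α β}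

/-- The vertices `x` and `y` are joined by a walk with edges in `S`. -/
def JoinedBy (G : Graph α β) (S : Set β) (x y : α) : Prop :=
  Relation.ReflTransGen (G.restrict S).Adj x y

lemma restrict_adj_iff {S : Set β} {x y : α} :
    (G.restrict S).Adj x y ↔ ∃ e ∈ S, G.IsLink e x y := by
  simp [Adj, restrict]

namespace JoinedBy

variable {S T : Set β} {x y z : α}

lemma refl (S : Set β) (x : α) : G.JoinedBy S x x := Relation.ReflTransGen.refl

lemma trans (h : G.JoinedBy S x y) (h' : G.JoinedBy S y z) : G.JoinedBy S x z :=
  Relation.ReflTransGen.trans h h'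

lemma symm (h : G.JoinedBy S x y) : G.JoinedBy S y x :=
  have : Std.Symm (G.restrict S).Adj := ⟨fun _ _ h ↦ Adj.symm h⟩
  (Relation.ReflTransGen.stdSymm (r := (G.restrict S).Adj)).symm _ _ h

lemma of_isLink {e : β} (he : e ∈ S) (h : G.IsLink e x y) : G.JoinedBy S x y :=
  Relation.ReflTransGen.single (restrict_adj_iff.2 ⟨e, he, h⟩)

lemma mono (hST : S ⊆ T) (h : G.JoinedBy S x y) : G.JoinedBy T x y :=
  Relation.ReflTransGen.mono (p := (G.restrict T).Adj) (fun _ _ h ↦ by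
    obtain ⟨e, he, h⟩ := restrict_adj_iff.1 h
    exact restrict_adj_iff.2 ⟨e, hST he, h⟩) _ _ h

/-- Edges whose ends are joined by the other edges may be left out. -/
lemma of_forall (hST : ∀ e ∈ S, ∀ x y, G.IsLink e x y → G.JoinedBy T x y)
    (h : G.JoinedBy S x y) : G.JoinedBy T x y := by
  induction h with
  | refl => exact refl _ _
  | tail _ h ih =>
    obtain ⟨e, he, h⟩ := restrict_adj_iff.1 h
    exact ih.trans (hST e he _ _ h)

end JoinedBy

/-- No edge in `T` has ends that are joined by the other edges in `T`. -/
def IsForestSet (G : Graph α β) (T : Set β) : Prop :=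
  ∀ e ∈ T, ∀ x y, G.IsLink e x y → ¬ G.JoinedBy (T \ {e}) x y

lemma IsForestSet.mono {S T : Set β} (h : G.IsForestSet T) (hST : S ⊆ T) : G.IsForestSet S :=
  fun e he x y hxy hj ↦ h e (hST he) x y hxy (hj.mono (Set.sdiff_subset_sdiff_left hST))

/-- The last edge of a cycle has its ends joined by the walk through the other edges. -/
lemma IsCycle.exists_joinedBy {T : Set β} {k : ℕ} {v : Fin (k + 1) → α} {e : Fin (k + 1) → β}
    (h : (G.restrict T).IsCycle v e) :
    ∃ e ∈ T, ∃ x y, G.IsLink e x y ∧ G.JoinedBy (T \ {e}) x y := by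
  obtain ⟨hv, he, hl⟩ := h
  have hl : ∀ i, e i ∈ T ∧ G.IsLink (e i) (v i) (v (i + 1)) := hl
  have hj : ∀ i : Fin (k + 1), G.JoinedBy (T \ {e (Fin.last k)}) (v 0) (v i) := by
    intro i
    induction i using Fin.induction with
    | zero => exact .refl _ _
    | succ i ih =>
      refine ih.trans (.of_isLink (e := e i.castSucc) ⟨(hl _).1, fun h ↦ ?_⟩ ?_)
      · exact (Fin.castSucc_lt_last i).ne (he h)
      · simpa [Fin.coeSucc_eq_succ] using (hl i.castSucc).2
  have := hl (Fin.last k)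
  rw [Fin.last_add_one] at this
  exact ⟨_, this.1, _, _, this.2, (hj _).symm⟩

/-- A path without repeated vertices from `x` to `y` avoiding `e₀` is closed up by `e₀`; for a loop
the path has length 0. -/
lemma exists_isCycle {T : Set β} {e₀ : β} (he₀ : e₀ ∈ T) {x y : α} (hxy : G.IsLink e₀ x y)
    (hj : G.JoinedBy (T \ {e₀}) x y) :
    ∃ (k : ℕ) (v : Fin (k + 1) → α) (e : Fin (k + 1) → β), (G.restrict T).IsCycle v e := by
  classical
  let H : SimpleGraph α := SimpleGraph.fromRel fun a b ↦ ∃ e ∈ T \ {e₀}, G.IsLink e a b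
  have hH : ∀ a b, H.Adj a b → ∃ e ∈ T \ {e₀}, G.IsLink e a b := by
    rintro a b ⟨-, h | ⟨e, he, h⟩⟩
    · exact h
    · exact ⟨e, he, h.symm⟩
  have hr : ∀ z, G.JoinedBy (T \ {e₀}) x z → H.Reachable x z := by
    intro z hz
    induction hz with
    | refl => exact SimpleGraph.Reachable.refl _
    | @tail b c _ h ih =>
      by_cases hbc : b = c
      · exact hbc ▸ ih
      · exact ih.trans (SimpleGraph.Adj.reachable
          ((SimpleGraph.fromRel_adj _ _ _).2 ⟨hbc, Or.inl (restrict_adj_iff.1 h)⟩))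
  obtain ⟨w⟩ := hr y hj
  obtain ⟨p, hp⟩ : ∃ p : H.Walk x y, p.IsPath := ⟨w.toPath, w.toPath.2⟩
  have hinj : ∀ i j, i ≤ p.length → j ≤ p.length → p.getVert i = p.getVert j → i = j :=
    fun i j hi hj h ↦ hp.getVert_injOn hi hj h
  have : Nonempty β := ⟨e₀⟩
  choose! c hcT hc using fun (i : ℕ) (hi : i < p.length) ↦ hH _ _ (p.adj_getVert_succ hi)
  refine ⟨p.length, fun i ↦ p.getVert i, fun i ↦ if (i : ℕ) < p.length then c i else e₀,
    fun i j hij ↦ Fin.ext (hinj _ _ (by omega) (by omega) hij), fun i j hij ↦ ?_, fun i ↦ ?_⟩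
  · have hi := i.2
    have hj := j.2
    apply Fin.ext
    dsimp only at hij
    split_ifs at hij with h1 h2 h2
    · have h3 := hc i h1
      rw [hij] at h3
      -- An edge used at `i` and `j` has the same ends both times; in reversed order this would give
      -- `i = j + 1` and `i + 1 = j`.
      rcases h3.eq_and_eq_or_eq_and_eq (hc j h2) with h | h
      · exact hinj _ _ (by omega) (by omega) h.1
      · have h4 := hinj _ _ (by omega) (by omega) h.1
        have h5 := hinj _ _ (by omega) (by omega) h.2
        omega
    · exact absurd hij (hcT i h1).2
    · exact absurd hij.symm (hcT j h2).2
    · omega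
  · by_cases hi : (i : ℕ) < p.length
    · have h1 : ((i + 1 : Fin (p.length + 1)) : ℕ) = i + 1 := Fin.val_add_one_of_lt' (by omega)
      simp only [hi, if_true, h1]
      exact ⟨(hcT i hi).1, hc i hi⟩
    · obtain rfl : i = Fin.last p.length := Fin.ext (by simp; omega)
      simpa [restrict] using ⟨he₀, hxy.symm⟩

lemma isTree_restrict_iff {T : Set β} :
    (G.restrict T).IsTree ↔ (G.restrict T).IsConnected ∧ G.IsForestSet T := by
  refine and_congr_right fun _ ↦ ⟨fun h e he x y hxy hj ↦ ?_, fun h k v e hc ↦ ?_⟩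
  · obtain ⟨k, v, e, hc⟩ := exists_isCycle he hxy hj
    exact h k v e hc
  · obtain ⟨e, he, x, y, hxy, hj⟩ := hc.exists_joinedBy
    exact h e he x y hxy hj

/-- An edge is dispensable for connectedness iff its ends are joined by the others. This form speaks
of connectedness only, which is what topology detects in the dual graph. -/
lemma isTree_restrict_iff' {T : Set β} (hT : T ⊆ G.edgeSet) :
    (G.restrict T).IsTree ↔ (G.restrict T).IsConnected ∧
      ∀ e ∈ T, ¬ (G.restrict (T \ {e})).IsConnected := by
  rw [isTree_restrict_iff]
  refine and_congr_right fun hc ↦ ⟨fun h e he hc' ↦ ?_, fun h e he x y hxy hj ↦ ?_⟩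
  · obtain ⟨x, y, hxy⟩ := exists_isLink_of_mem_edgeSet (hT he)
    exact h e he x y hxy (hc'.2 x hxy.left_mem y hxy.right_mem)
  · refine h e he ⟨hc.1, fun a ha b hb ↦ ?_⟩
    refine JoinedBy.of_forall (S := T) (fun e' he' a b hab ↦ ?_) (hc.2 a ha b hb)
    by_cases h : e' = e
    · subst h
      rcases hab.eq_and_eq_or_eq_and_eq hxy with ⟨rfl, rfl⟩ | ⟨rfl, rfl⟩
      · exact hj
      · exact hj.symm
    · exact .of_isLink ⟨he', h⟩ hab

/-- A connected graph with finitely many edges has finitely many vertices. -/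
lemma IsConnected.finite_vertexSet (h : G.IsConnected) (hE : G.edgeSet.Finite) :
    G.vertexSet.Finite := by
  obtain ⟨⟨v₀, hv₀⟩, h⟩ := h
  have : G.vertexSet ⊆ insert v₀ (⋃ e ∈ G.edgeSet, {x | G.Inc e x}) := by
    intro v hv
    rcases Relation.ReflTransGen.cases_tail (h v₀ hv₀ v hv) with rfl | ⟨c, -, e, he⟩
    · exact Set.mem_insert _ _
    · exact Or.inr (Set.mem_biUnion he.edge_mem he.inc_right)
  refine ((hE.biUnion fun e he ↦ ?_).insert v₀).subset this
  obtain ⟨x, y, hxy⟩ := exists_isLink_of_mem_edgeSet he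
  exact (Set.toFinite {x, y}).subset fun z hz ↦ Inc.eq_or_eq_of_isLink hz hxy

/-- If the edges in `T` do not connect the connected graph `G`, then some edge of `G` has ends
that are not joined by edges in `T`. -/
lemma IsConnected.exists_not_joinedBy (h : G.IsConnected) {T : Set β}
    (hT : ¬ (G.restrict T).IsConnected) :
    ∃ e ∈ G.edgeSet, ∃ x y, G.IsLink e x y ∧ ¬ G.JoinedBy T x y := by
  by_contra! hcon
  refine hT ⟨h.1, fun x hx y hy ↦ ?_⟩
  refine JoinedBy.of_forall (S := G.edgeSet) hcon ?_
  unfold JoinedBy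
  rw [restrict_self]
  exact h.2 x hx y hy

end Graph

/-!
### Logarithms on subgraphs of an embedded graph
-/

/-- Every continuous function without zeros on `s` has a continuous logarithm. -/
def HasAllLogs {X : Type*} [TopologicalSpace X] (s : Set X) : Prop :=
  ∀ f : X → ℂ, ContinuousOn f s → (∀ x ∈ s, f x ≠ 0) → HasLogOn f s

/-- Continuous functions without zeros on an arc have logarithms. -/
lemma hasAllLogs_range {X : Type*} [TopologicalSpace X] [T2Space X] {γ : I → X}
    (hγ : Continuous γ) (hinj : Function.Injective γ) : HasAllLogs (Set.range γ) := by
  classical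
  intro f hf hf0
  have hfc : Continuous (f ∘ γ) := hf.comp_continuous hγ Set.mem_range_self
  have h1 : HasLogOn (f ∘ γ) Set.univ := by
    have := HasLogOn.of_homotopy (s := (Set.univ : Set I)) (fun t s ↦ (f ∘ γ) (t * s))
      (hfc.comp (continuous_fst.mul continuous_snd)).continuousOn
      (fun _ _ _ ↦ hf0 _ (Set.mem_range_self _))
      (by simpa using HasLogOn.const (hf0 _ (Set.mem_range_self 0)) _)
    simpa only [one_mul] using this
  obtain ⟨g, hg, hgf⟩ := h1
  let φ : I ≃ₜ Set.range γ := (hγ.isClosedEmbedding hinj).isEmbedding.toHomeomorph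
  have hφ : ∀ t, (φ t : X) = γ t := fun _ ↦ rfl
  refine ⟨fun x ↦ if hx : x ∈ Set.range γ then g (φ.symm ⟨x, hx⟩) else 0, ?_, fun x hx ↦ ?_⟩
  · rw [continuousOn_iff_continuous_domRestrict]
    have : Continuous fun x : Set.range γ ↦ g (φ.symm x) :=
      (continuousOn_univ.1 hg).comp φ.symm.continuous
    convert this using 1
    ext x
    simp [Set.domRestrict]
  · simp only [hx, dif_pos]
    rw [hgf _ (Set.mem_univ _), Function.comp, ← hφ, φ.apply_symm_apply]

lemma HasAllLogs.union {X : Type*} [TopologicalSpace X] {A B : Set X} (hA : HasAllLogs A)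
    (hB : HasAllLogs B) (hA' : IsClosed A) (hB' : IsClosed B) (hAB : (A ∩ B).Subsingleton) :
    HasAllLogs (A ∪ B) := fun f hf hf0 ↦
  (hA f (hf.mono Set.subset_union_left) fun x hx ↦ hf0 x (Or.inl hx)).union_of_isClosed
    (hB f (hf.mono Set.subset_union_right) fun x hx ↦ hf0 x (Or.inr hx)) hA' hB' hAB.isPreconnected

/-- Logarithms on a union of two disjoint closed sets can be restricted to one of the two. -/
lemma HasAllLogs.of_union_left {X : Type*} [TopologicalSpace X] {A B : Set X}
    (h : HasAllLogs (A ∪ B)) (hA : IsClosed A) (hB : IsClosed B) (hAB : A ∩ B = ∅) :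
    HasAllLogs A := by
  classical
  intro f hf hf0
  have hne : ∀ x ∈ B, x ∉ A := fun x hB hA ↦ (hAB ▸ (⟨hA, hB⟩ : x ∈ A ∩ B) : x ∈ (∅ : Set X))
  have h1 : Set.EqOn (A.piecewise f 1) f A := Set.piecewise_eqOn _ _ _
  have h2 : Set.EqOn (A.piecewise f 1) 1 B := fun x hx ↦ by simp [hne x hx]
  refine ((h (A.piecewise f 1) ?_ ?_).mono Set.subset_union_left).congr h1
  · exact (hf.congr h1).union_of_isClosed (continuousOn_const.congr h2) hA hB
  · rintro x (hx | hx)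
    · rw [h1 hx]
      exact hf0 x hx
    · rw [h2 hx]
      exact one_ne_zero

/-- For any two points off `K`, a coordinate with its zero at one and its pole at the other has a
logarithm on `K`, so they lie in one component. -/
lemma HasAllLogs.isPreconnected_compl {K : Set Graph.TwoSphere} (h : HasAllLogs K)
    (hK : IsClosed K) : IsPreconnected Kᶜ := by
  refine isPreconnected_of_forall_pair fun p hp q hq ↦ ?_
  by_cases hpq : p = q
  · exact ⟨{p}, by simpa using hp, rfl, hpq ▸ rfl, isPreconnected_singleton⟩
  refine ⟨connectedComponentIn Kᶜ p, connectedComponentIn_subset _ _,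
    mem_connectedComponentIn hp, ?_, isPreconnected_connectedComponentIn⟩
  have hKq : K ⊆ {q}ᶜ := fun z hz hzq ↦ hq (hzq ▸ hz)
  refine TwoSphere.mem_connectedComponentIn_of_hasLogOn hK hp hq hpq (h _ ?_ fun z hz h0 ↦ ?_)
  · exact ((TwoSphere.continuousOn_chart q).mono hKq).sub continuousOn_const
  · exact hp (TwoSphere.chart_injOn q (hKq hz) hpq (sub_eq_zero.1 h0) ▸ hz)

/-- A frontier point inside `U` could be added to the component without losing connectedness, but
the component is open and so contains none of its frontier. -/
lemma frontier_connectedComponentIn_subset {X : Type*} [TopologicalSpace X]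
    [LocallyConnectedSpace X] {U : Set X} (hU : IsOpen U) (p : X) :
    frontier (connectedComponentIn U p) ⊆ Uᶜ := by
  intro z hz hzU
  have hWo : IsOpen (connectedComponentIn U p) := hU.connectedComponentIn
  rw [hWo.frontier_eq] at hz
  refine hz.2 ?_
  by_cases hp : p ∈ U
  · have hpre : IsPreconnected (insert z (connectedComponentIn U p)) :=
      isPreconnected_connectedComponentIn.subset_closure (Set.subset_insert _ _)
        (Set.insert_subset hz.1 subset_closure)
    exact hpre.subset_connectedComponentIn (Set.mem_insert_of_mem _ (mem_connectedComponentIn hp))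
      (Set.insert_subset hzU (connectedComponentIn_subset _ _)) (Set.mem_insert _ _)
  · simp [connectedComponentIn_eq_empty hp] at hz

namespace Graph.SphereEmbedding

variable {α β : Type*} {G : Graph α β} (f : G.SphereEmbedding)

/-! ### Subgraphs as subsets of the sphere -/

/-- The union of the points of the vertices in `U` and the open arcs of the edges in `S`. -/
def part (U : Set α) (S : Set β) : Set TwoSphere := f.point '' U ∪ ⋃ e ∈ S, f.openArc e

variable {f} {U U' : Set α} {S S' : Set β}

lemma mem_part {z : TwoSphere} :
    z ∈ f.part U S ↔ (∃ v ∈ U, f.point v = z) ∨ ∃ e ∈ S, z ∈ f.openArc e := by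
  simp [part]

lemma part_union : f.part (U ∪ U') (S ∪ S') = f.part U S ∪ f.part U' S' := by
  rw [part, part, part, Set.image_union, Set.biUnion_union, Set.union_union_union_comm]

lemma part_mono (hU : U ⊆ U') (hS : S ⊆ S') : f.part U S ⊆ f.part U' S' :=
  Set.union_subset_union (Set.image_mono hU) (Set.biUnion_subset_biUnion_left hS)

lemma openArc_subset_part {e : β} (he : e ∈ S) : f.openArc e ⊆ f.part U S :=
  fun _ hz ↦ mem_part.2 (Or.inr ⟨e, he, hz⟩)

lemma point_mem_part {v : α} (hv : v ∈ U) : f.point v ∈ f.part U S :=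
  mem_part.2 (Or.inl ⟨v, hv, rfl⟩)

lemma point_notMem_openArc {v : α} (hv : v ∈ G.vertexSet) {e : β} (he : e ∈ G.edgeSet) :
    f.point v ∉ f.openArc e := by
  rintro ⟨t, ht, h⟩
  exact f.arc_ne_point e he t ht v hv h

lemma eq_of_mem_openArc {e e' : β} (he : e ∈ G.edgeSet) (he' : e' ∈ G.edgeSet) {z : TwoSphere}
    (h : z ∈ f.openArc e) (h' : z ∈ f.openArc e') : e = e' := by
  by_contra hne
  exact Set.disjoint_left.1 (f.arc_disjoint e he e' he' hne) h h'

lemma openArc_disjoint_part {e : β} (he : e ∈ G.edgeSet) (hU : U ⊆ G.vertexSet)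
    (hS : S ⊆ G.edgeSet) (heS : e ∉ S) : Disjoint (f.openArc e) (f.part U S) := by
  refine Set.disjoint_left.2 fun z hz hz' ↦ ?_
  rcases mem_part.1 hz' with ⟨v, hv, rfl⟩ | ⟨e', he', h⟩
  · exact point_notMem_openArc (hU hv) he hz
  · exact heS (eq_of_mem_openArc he (hS he') hz h ▸ he')

lemma part_inter (hU : U ⊆ G.vertexSet) (hU' : U' ⊆ G.vertexSet) (hS : S ⊆ G.edgeSet)
    (hS' : S' ⊆ G.edgeSet) : f.part U S ∩ f.part U' S' = f.part (U ∩ U') (S ∩ S') := by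
  refine subset_antisymm ?_ (Set.subset_inter
    (part_mono Set.inter_subset_left Set.inter_subset_left)
    (part_mono Set.inter_subset_right Set.inter_subset_right))
  rintro z ⟨hz, hz'⟩
  rcases mem_part.1 hz with ⟨v, hv, rfl⟩ | ⟨e, he, h⟩
  · rcases mem_part.1 hz' with ⟨v', hv', h'⟩ | ⟨e', he', h'⟩
    · obtain rfl := f.point_injOn (hU' hv') (hU hv) h'
      exact point_mem_part ⟨hv, hv'⟩
    · exact absurd h' (point_notMem_openArc (hU hv) (hS' he'))
  · rcases mem_part.1 hz' with ⟨v', hv', rfl⟩ | ⟨e', he', h'⟩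
    · exact absurd h (point_notMem_openArc (hU' hv') (hS he))
    · obtain rfl := eq_of_mem_openArc (hS he) (hS' he') h h'
      exact mem_part.2 (Or.inr ⟨e, ⟨he, he'⟩, h⟩)

lemma range_arc_eq (e : β) : Set.range (f.arc e) = {f.arc e 0, f.arc e 1} ∪ f.openArc e := by
  ext z
  constructor
  · rintro ⟨t, rfl⟩
    rcases eq_or_lt_of_le (unitInterval.nonneg t) with h | h
    · exact Or.inl (Or.inl (congrArg _ (Subtype.ext h.symm)))
    rcases eq_or_lt_of_le (unitInterval.le_one t) with h' | h'
    · exact Or.inl (Or.inr (congrArg _ (Subtype.ext h')))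
    · exact Or.inr ⟨t, ⟨h, h'⟩, rfl⟩
  · rintro ((rfl | rfl) | ⟨t, -, rfl⟩) <;> exact Set.mem_range_self _

lemma range_arc_eq_part {e : β} {x y : α} (h : G.IsLink e x y) :
    Set.range (f.arc e) = f.part {x, y} {e} := by
  obtain ⟨x', y', h', h0, h1⟩ := f.arc_ends e h.edge_mem
  rw [range_arc_eq, h0, h1]
  rcases h.eq_and_eq_or_eq_and_eq h' with ⟨rfl, rfl⟩ | ⟨rfl, rfl⟩
  · simp [part, Set.image_pair]
  · simp [part, Set.image_pair, Set.pair_comm]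

/-- Since `U` contains the ends of all edges in `S`, the open arcs may be replaced by the full,
compact ones. -/
lemma isClosed_part (hU : U.Finite) (hS : S.Finite)
    (hSU : ∀ e ∈ S, ∀ x y, G.IsLink e x y → x ∈ U) (hSE : S ⊆ G.edgeSet) :
    IsClosed (f.part U S) := by
  have : f.part U S = f.point '' U ∪ ⋃ e ∈ S, Set.range (f.arc e) := by
    refine subset_antisymm ?_ (Set.union_subset Set.subset_union_left ?_)
    · refine Set.union_subset_union_right _ (Set.iUnion₂_mono fun e _ ↦ ?_)
      exact Set.image_subset_range _ _
    · refine Set.iUnion₂_subset fun e he ↦ ?_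
      obtain ⟨x, y, h⟩ := exists_isLink_of_mem_edgeSet (hSE he)
      rw [range_arc_eq_part h]
      refine part_mono ?_ (Set.singleton_subset_iff.2 he)
      exact Set.pair_subset (hSU e he x y h) (hSU e he y x h.symm)
  rw [this]
  refine ((hU.image _).isClosed).union (hS.isClosed_biUnion fun e _ ↦ ?_)
  exact (isCompact_range (f.arc e).continuous).isClosed

lemma support_eq_part : f.support = f.part G.vertexSet G.edgeSet := by
  refine subset_antisymm (Set.union_subset Set.subset_union_left ?_)
    (Set.union_subset_union_right _ (Set.iUnion₂_mono fun e _ ↦ Set.image_subset_range _ _))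
  refine Set.iUnion₂_subset fun e he ↦ ?_
  obtain ⟨x, y, h⟩ := exists_isLink_of_mem_edgeSet he
  rw [range_arc_eq_part h]
  exact part_mono (Set.pair_subset h.left_mem h.right_mem) (Set.singleton_subset_iff.2 he)

lemma isClosed_part_vertexSet (hV : G.vertexSet.Finite) (hE : G.edgeSet.Finite)
    (hS : S ⊆ G.edgeSet) : IsClosed (f.part G.vertexSet S) :=
  isClosed_part hV (hE.subset hS) (fun _ _ _ _ h ↦ h.left_mem) hS

/-- An arc is injective away from one of its end points, and everywhere if it is not a loop. -/
lemma arc_injOn_Ico {e : β} (he : e ∈ G.edgeSet) : Set.InjOn (f.arc e) (Set.Ico 0 1) := by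
  obtain ⟨x, y, h, h0, -⟩ := f.arc_ends e he
  intro s hs t ht hst
  rcases eq_or_lt_of_le hs.1 with rfl | hs0 <;> rcases eq_or_lt_of_le ht.1 with rfl | ht0
  · rfl
  · exact absurd (h0.symm.trans hst).symm (f.arc_ne_point e he t ⟨ht0, ht.2⟩ x h.left_mem)
  · exact absurd (hst.trans h0) (f.arc_ne_point e he s ⟨hs0, hs.2⟩ x h.left_mem)
  · exact f.arc_injOn e he ⟨hs0, hs.2⟩ ⟨ht0, ht.2⟩ hst

lemma arc_injOn_Ioc {e : β} (he : e ∈ G.edgeSet) : Set.InjOn (f.arc e) (Set.Ioc 0 1) := by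
  obtain ⟨x, y, h, -, h1⟩ := f.arc_ends e he
  intro s hs t ht hst
  rcases eq_or_lt_of_le hs.2 with rfl | hs1 <;> rcases eq_or_lt_of_le ht.2 with rfl | ht1
  · rfl
  · exact absurd (h1.symm.trans hst).symm (f.arc_ne_point e he t ⟨ht.1, ht1⟩ y h.right_mem)
  · exact absurd (hst.trans h1) (f.arc_ne_point e he s ⟨hs.1, hs1⟩ y h.right_mem)
  · exact f.arc_injOn e he ⟨hs.1, hs1⟩ ⟨ht.1, ht1⟩ hst

lemma arc_injective {e : β} {x y : α} (h : G.IsLink e x y) (hxy : x ≠ y) :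
    Function.Injective (f.arc e) := by
  obtain ⟨x', y', h', h0, h1⟩ := f.arc_ends e h.edge_mem
  have hne : f.arc e 0 ≠ f.arc e 1 := by
    rw [h0, h1]
    intro hp
    have := f.point_injOn h'.left_mem h'.right_mem hp
    subst this
    rcases h.eq_and_eq_or_eq_and_eq h' with ⟨rfl, rfl⟩ | ⟨rfl, rfl⟩ <;> exact hxy rfl
  intro s t hst
  by_cases hs : s = 1
  · by_cases ht : t = 1
    · rw [hs, ht]
    · by_cases ht0 : t = 0
      · subst hs ht0
        exact absurd hst.symm hne
      · exact arc_injOn_Ioc h.edge_mem ⟨by simp [hs], unitInterval.le_one _⟩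
          ⟨unitInterval.pos_iff_ne_zero.2 ht0, unitInterval.le_one _⟩ hst
  · by_cases ht : t = 1
    · by_cases hs0 : s = 0
      · subst ht hs0
        exact absurd hst hne
      · exact arc_injOn_Ioc h.edge_mem ⟨unitInterval.pos_iff_ne_zero.2 hs0, unitInterval.le_one _⟩
          ⟨by simp [ht], unitInterval.le_one _⟩ hst
    · exact arc_injOn_Ico h.edge_mem ⟨unitInterval.nonneg _, unitInterval.lt_one_iff_ne_one.2 hs⟩
        ⟨unitInterval.nonneg _, unitInterval.lt_one_iff_ne_one.2 ht⟩ hst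

/-- Reparametrises an initial piece by the whole interval, so that `hasAllLogs_range` applies to
proper pieces of loops too. -/
lemma image_Icc_zero_eq (γ : C(I, TwoSphere)) (s : I) :
    γ '' Set.Icc 0 s = Set.range fun t ↦ γ (t * s) := by
  ext z
  constructor
  · rintro ⟨t, ht, rfl⟩
    by_cases hs : s = 0
    · subst hs
      exact ⟨0, by simp [le_antisymm ht.2 ht.1]⟩
    · have hs' : (0 : ℝ) < s := unitInterval.pos_iff_ne_zero.2 hs
      refine ⟨⟨t / s, div_nonneg t.2.1 s.2.1, (div_le_one hs').2 ht.2⟩, congrArg γ ?_⟩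
      exact Subtype.ext (div_mul_cancel₀ _ hs'.ne')
  · rintro ⟨t, rfl⟩
    exact ⟨t * s, ⟨unitInterval.nonneg _, unitInterval.mul_le_right⟩, rfl⟩

lemma hasAllLogs_image_Icc_zero {γ : C(I, TwoSphere)} (hγ : Set.InjOn γ (Set.Ico 0 1)) {s : I}
    (hs : 0 < s) (hs1 : s < 1) : HasAllLogs (γ '' Set.Icc 0 s) := by
  rw [image_Icc_zero_eq]
  refine hasAllLogs_range (by fun_prop) fun t t' h ↦ ?_
  have h1 : ∀ t : I, t * s ∈ Set.Ico 0 1 := fun t ↦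
    ⟨unitInterval.nonneg _, unitInterval.mul_le_right.trans_lt hs1⟩
  have h2 := congrArg Subtype.val (hγ (h1 t) (h1 t') h)
  exact Subtype.ext (mul_right_cancel₀ (show (s : ℝ) ≠ 0 from (show (0 : ℝ) < s from hs).ne') h2)

lemma hasAllLogs_image_Icc_one {γ : C(I, TwoSphere)} (hγ : Set.InjOn γ (Set.Ioc 0 1)) {s : I}
    (hs : 0 < s) (hs1 : s < 1) : HasAllLogs (γ '' Set.Icc s 1) := by
  have h := hasAllLogs_image_Icc_zero (γ := γ.comp ⟨unitInterval.symm, by fun_prop⟩)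
    (s := unitInterval.symm s) (fun t ht t' ht' h ↦ ?_) (unitInterval.pos_iff_ne_zero.2 ?_)
    (unitInterval.lt_one_iff_ne_one.2 ?_)
  · convert h using 1
    ext z
    constructor
    · rintro ⟨t, ht, rfl⟩
      exact ⟨unitInterval.symm t, ⟨unitInterval.nonneg _, unitInterval.symm_le_symm.2 ht.1⟩,
        by simp⟩
    · rintro ⟨t, ht, rfl⟩
      refine ⟨unitInterval.symm t, ⟨?_, unitInterval.le_one _⟩, rfl⟩
      have := unitInterval.symm_le_symm.2 ht.2
      simpa using this
  · have h1 : ∀ t ∈ Set.Ico (0 : I) 1, unitInterval.symm t ∈ Set.Ioc (0 : I) 1 := fun t ht ↦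
      ⟨unitInterval.pos_iff_ne_zero.2 fun h ↦ ht.2.ne (unitInterval.symm_eq_zero.1 h),
        unitInterval.le_one _⟩
    exact unitInterval.symm_bijective.injective (hγ (h1 t ht) (h1 t' ht') h)
  · exact fun h ↦ hs1.ne (unitInterval.symm_eq_zero.1 h)
  · exact fun h ↦ hs.ne' (unitInterval.symm_eq_one.1 h)

/-- Logarithms extend over an additional edge that joins two components. -/
lemma HasAllLogs.part_insert (hV : G.vertexSet.Finite) (hE : G.edgeSet.Finite)
    (hS : S ⊆ G.edgeSet) {e : β} {x y : α} (hxy : G.IsLink e x y) (hj : ¬ G.JoinedBy S x y)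
    (h : HasAllLogs (f.part G.vertexSet S)) : HasAllLogs (f.part G.vertexSet (insert e S)) := by
  have heS : e ∉ S := fun he ↦ hj (.of_isLink he hxy)
  -- `U` and `F` form the component of `x`. It and the rest are disjoint closed sets carrying all
  -- logarithms; the new arc meets the first only in `x`, and their union meets the rest only in
  -- `y`.
  let U : Set α := {v ∈ G.vertexSet | G.JoinedBy S x v}
  let F : Set β := {e ∈ S | ∃ u v, G.IsLink e u v ∧ u ∈ U}
  have hUV : U ⊆ G.vertexSet := fun v hv ↦ hv.1
  have hFS : F ⊆ S := fun e he ↦ he.1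
  have hxU : x ∈ U := ⟨hxy.left_mem, .refl _ _⟩
  have hyU : y ∉ U := fun h ↦ hj h.2
  have hF : ∀ e ∈ F, ∀ u v, G.IsLink e u v → u ∈ U := by
    rintro e ⟨he, u', v', h', hu'⟩ u v huv
    have hv' : v' ∈ U := ⟨h'.right_mem, hu'.2.trans (.of_isLink he h')⟩
    rcases huv.left_eq_or_eq h' with rfl | rfl
    · exact hu'
    · exact hv'
  have hAc : IsClosed (f.part U F) :=
    isClosed_part (hV.subset hUV) (hE.subset (hFS.trans hS)) hF (hFS.trans hS)
  have hBc : IsClosed (f.part (G.vertexSet \ U) (S \ F)) := by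
    refine isClosed_part (hV.subset Set.sdiff_subset) (hE.subset (Set.sdiff_subset.trans hS)) ?_
      (Set.sdiff_subset.trans hS)
    exact fun e he u v huv ↦ ⟨huv.left_mem, fun hu ↦ he.2 ⟨he.1, u, v, huv, hu⟩⟩
  have hsplit : f.part G.vertexSet S = f.part U F ∪ f.part (G.vertexSet \ U) (S \ F) := by
    rw [← part_union, Set.union_sdiff_cancel hUV, Set.union_sdiff_cancel hFS]
  have hdisj : f.part U F ∩ f.part (G.vertexSet \ U) (S \ F) = ∅ := by
    rw [part_inter hUV Set.sdiff_subset (hFS.trans hS) (Set.sdiff_subset.trans hS)]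
    simp [part]
  rw [hsplit] at h
  have hA := h.of_union_left hAc hBc hdisj
  have hB := HasAllLogs.of_union_left (Set.union_comm _ _ ▸ h) hBc hAc (Set.inter_comm _ _ ▸ hdisj)
  have hxy' : ({x, y} : Set α) ⊆ G.vertexSet := Set.pair_subset hxy.left_mem hxy.right_mem
  have heE : ({e} : Set β) ⊆ G.edgeSet := Set.singleton_subset_iff.2 hxy.edge_mem
  have harc : HasAllLogs (f.part {x, y} {e}) := by
    rw [← range_arc_eq_part hxy]
    exact hasAllLogs_range (f.arc e).continuous
      (arc_injective hxy fun h ↦ hj (h ▸ .refl _ _))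
  have harcc : IsClosed (f.part {x, y} {e}) := by
    rw [← range_arc_eq_part hxy]
    exact (isCompact_range (f.arc e).continuous).isClosed
  have hsub : ∀ (W : Set α) (D : Set β) (v : α), W ⊆ {v} → D ⊆ ∅ → (f.part W D).Subsingleton := by
    intro W D v hW hD
    refine Set.Subsingleton.anti (Set.subsingleton_singleton (a := f.point v)) ?_
    refine (part_mono hW hD).trans ?_
    simp [part]
  have h1 := hA.union harc hAc harcc (by
    rw [part_inter hUV hxy' (hFS.trans hS) heE]
    refine hsub _ _ x ?_ ?_
    · rintro v ⟨hv, rfl | rfl⟩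
      · rfl
      · exact absurd hv hyU
    · rintro e' ⟨he', rfl⟩
      exact heS (hFS he'))
  have h2 := h1.union hB (hAc.union harcc) hBc (by
    rw [← part_union, part_inter (Set.union_subset hUV hxy') Set.sdiff_subset
      (Set.union_subset (hFS.trans hS) heE) (Set.sdiff_subset.trans hS)]
    refine hsub _ _ y ?_ ?_
    · rintro v ⟨hv | rfl | rfl, hv'⟩
      · exact absurd hv hv'.2
      · exact absurd hxU hv'.2
      · rfl
    · rintro e' ⟨he' | rfl, he''⟩
      · exact absurd he' he''.2
      · exact absurd he''.1 heS)
  convert h2 using 1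
  rw [Set.union_right_comm, ← hsplit, ← part_union, Set.union_eq_left.2 hxy', Set.union_comm S,
    Set.singleton_union]

/-- The forest grows edge by edge, each joining two components; it starts from finitely many points,
on which every function is continuous. -/
lemma hasAllLogs_part_of_isForestSet (hV : G.vertexSet.Finite) (hE : G.edgeSet.Finite)
    (hS : S ⊆ G.edgeSet) (hf : G.IsForestSet S) : HasAllLogs (f.part G.vertexSet S) := by
  induction S, hE.subset hS using Set.Finite.induction_on with
  | empty =>
    have : f.part G.vertexSet ∅ = f.point '' G.vertexSet := by simp [part]
    rw [this]
    intro g hg hg0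
    refine ⟨fun z ↦ Complex.log (g z), ?_, fun z hz ↦ Complex.exp_log (hg0 z hz)⟩
    exact (hV.image _).continuousOn _
  | @insert e S heS _ ih =>
    have hS' : S ⊆ G.edgeSet := (Set.subset_insert _ _).trans hS
    obtain ⟨x, y, hxy⟩ := exists_isLink_of_mem_edgeSet (hS (Set.mem_insert e S))
    refine HasAllLogs.part_insert hV hE hS' hxy ?_ (ih hS' (hf.mono (Set.subset_insert _ _)))
    have := hf e (Set.mem_insert _ _) x y hxy
    rwa [Set.insert_sdiff_self_of_notMem heS] at this

/-! ### Separation of the sphere by subgraphs -/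

lemma joinedIn_image_Icc (γ : C(I, TwoSphere)) {s t : I} (hst : s ≤ t) :
    JoinedIn (γ '' Set.Icc s t) (γ s) (γ t) := by
  have h := ((convex_Icc (s : ℝ) t).isPathConnected ⟨s, le_rfl, hst⟩).joinedIn s ⟨le_rfl, hst⟩ t
    ⟨hst, le_rfl⟩
  have h1 := h.map (f := γ ∘ Set.projIcc 0 1 zero_le_one) (by fun_prop)
  simp only [Function.comp, Set.projIcc_val] at h1
  refine h1.mono ?_
  rintro _ ⟨r, hr, rfl⟩
  have hr' : r ∈ Set.Icc (0 : ℝ) 1 := ⟨s.2.1.trans hr.1, hr.2.trans t.2.2⟩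
  exact ⟨⟨r, hr'⟩, hr, by simp [Set.projIcc_of_mem _ hr']⟩

lemma joinedIn_part {x y : α} (hx : x ∈ G.vertexSet) (h : G.JoinedBy S x y) :
    JoinedIn (f.part G.vertexSet S) (f.point x) (f.point y) := by
  induction h with
  | refl => exact JoinedIn.refl (point_mem_part hx)
  | tail _ h ih =>
    obtain ⟨e, he, h⟩ := restrict_adj_iff.1 h
    refine ih.trans ?_
    have h1 : JoinedIn (Set.range (f.arc e)) (f.arc e 0) (f.arc e 1) :=
      (joinedIn_image_Icc (f.arc e) zero_le_one).mono (Set.image_subset_range _ _)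
    have h2 := h1.mono ((range_arc_eq_part h).subset.trans
      (part_mono (Set.pair_subset h.left_mem h.right_mem) (Set.singleton_subset_iff.2 he)))
    obtain ⟨x', y', h', h0', h1'⟩ := f.arc_ends e h.edge_mem
    rw [h0', h1'] at h2
    rcases h.eq_and_eq_or_eq_and_eq h' with ⟨rfl, rfl⟩ | ⟨rfl, rfl⟩
    · exact h2
    · exact h2.symm

lemma range_arc_subset {e : β} (he : e ∈ G.edgeSet) :
    Set.range (f.arc e) ⊆ f.part G.vertexSet {e} := by
  obtain ⟨x, y, h⟩ := exists_isLink_of_mem_edgeSet he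
  rw [range_arc_eq_part h]
  exact part_mono (Set.pair_subset h.left_mem h.right_mem) subset_rfl

/-- A subgraph separates the sphere if the ends of one of its edges are joined by other edges. -/
lemma not_isConnected_compl_part (hV : G.vertexSet.Finite) (hE : G.edgeSet.Finite)
    (hS : S ⊆ G.edgeSet) {e : β} (he : e ∈ S) {x y : α} (hxy : G.IsLink e x y)
    (hj : G.JoinedBy (S \ {e}) x y) : ¬ _root_.IsConnected (f.part G.vertexSet S)ᶜ := by
  obtain ⟨s, hs0, hs1⟩ := exists_between (zero_lt_one (α := I))
  obtain ⟨t, hst, ht1⟩ := exists_between hs1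
  have hSe : S \ {e} ⊆ G.edgeSet := Set.sdiff_subset.trans hS
  have heE := hS he
  have hIcc : ∀ r ∈ Set.Icc s t, r ∈ Set.Ioo (0 : I) 1 :=
    fun r hr ↦ ⟨hs0.trans_le hr.1, hr.2.trans_lt ht1⟩
  -- The edge is cut at two interior points. The middle piece `A` and the rest `B` meet only there,
  -- and `B` joins the cut points through the two end pieces of `e` and the walk between its ends.
  -- This covers loops as well.
  set A := f.arc e '' Set.Icc s t with hA
  set B := f.part G.vertexSet (S \ {e}) ∪ (f.arc e '' Set.Icc 0 s ∪ f.arc e '' Set.Icc t 1) with hB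
  have hcl : ∀ a b : I, IsClosed (f.arc e '' Set.Icc a b) := fun a b ↦
    (isCompact_Icc.image (f.arc e).continuous).isClosed
  have hBc : IsClosed B :=
    (isClosed_part_vertexSet hV hE hSe).union ((hcl _ _).union (hcl _ _))
  have hAB : A ∪ B = f.part G.vertexSet S := by
    have h1 : A ∪ B = f.part G.vertexSet (S \ {e}) ∪ Set.range (f.arc e) := by
      have : Set.range (f.arc e) =
          f.arc e '' Set.Icc 0 s ∪ f.arc e '' Set.Icc s t ∪ f.arc e '' Set.Icc t 1 := by
        rw [← Set.image_union, ← Set.image_union, Set.Icc_union_Icc_eq_Icc hs0.le hst.le,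
          Set.Icc_union_Icc_eq_Icc (hs0.trans hst).le ht1.le, ← Set.image_univ]
        congr 1
        exact (Set.eq_univ_of_forall fun r : I ↦
          (⟨unitInterval.nonneg r, unitInterval.le_one r⟩ : r ∈ Set.Icc 0 1)).symm
      rw [this, hB]
      ac_rfl
    rw [h1]
    refine subset_antisymm (Set.union_subset (part_mono subset_rfl Set.sdiff_subset)
      ((range_arc_subset heE).trans (part_mono subset_rfl (Set.singleton_subset_iff.2 he)))) ?_
    intro z hz
    rcases mem_part.1 hz with ⟨v, hv, rfl⟩ | ⟨e', he', h⟩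
    · exact Or.inl (point_mem_part hv)
    · by_cases h' : e' = e
      · subst h'
        exact Or.inr (Set.image_subset_range _ _ h)
      · exact Or.inl (openArc_subset_part (S := S \ {e}) ⟨he', h'⟩ h)
  rw [← hAB]
  refine TwoSphere.not_isConnected_compl_union (a := f.arc e s) (b := f.arc e t) (hcl _ _) hBc
    (fun h ↦ hst.ne (f.arc_injOn e heE ⟨hs0, hs1⟩ ⟨hs0.trans hst, ht1⟩ h))
    (joinedIn_image_Icc _ hst.le) ?_ ?_
  · have h1 : JoinedIn B (f.arc e 0) (f.arc e s) := (joinedIn_image_Icc _ hs0.le).mono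
      (Set.subset_union_of_subset_right Set.subset_union_left _)
    have h2 : JoinedIn B (f.arc e t) (f.arc e 1) := (joinedIn_image_Icc _ ht1.le).mono
      (Set.subset_union_of_subset_right Set.subset_union_right _)
    have h3 : JoinedIn B (f.arc e 0) (f.arc e 1) := by
      obtain ⟨x', y', h', h0', h1'⟩ := f.arc_ends e heE
      rw [h0', h1']
      refine (joinedIn_part h'.left_mem ?_).mono Set.subset_union_left
      rcases hxy.eq_and_eq_or_eq_and_eq h' with ⟨rfl, rfl⟩ | ⟨rfl, rfl⟩
      · exact hj
      · exact hj.symm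
    exact h1.symm.trans (h3.trans h2.symm)
  · rintro _ ⟨⟨r, hr, rfl⟩, h | ⟨r', hr', h⟩ | ⟨r', hr', h⟩⟩
    · exact absurd h (Set.disjoint_left.1 (openArc_disjoint_part heE subset_rfl hSe fun h ↦ h.2 rfl)
        ⟨r, hIcc r hr, rfl⟩)
    · have := arc_injOn_Ico heE ⟨hr'.1, hr'.2.trans_lt hs1⟩ ⟨(hIcc r hr).1.le, (hIcc r hr).2⟩ h
      subst this
      exact Or.inl (congrArg _ (le_antisymm hr'.2 hr.1))
    · have := arc_injOn_Ioc heE ⟨(hs0.trans hst).trans_le hr'.1, hr'.2⟩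
        ⟨(hIcc r hr).1, (hIcc r hr).2.le⟩ h
      subst this
      exact Or.inr (congrArg _ (le_antisymm hr.2 hr'.1))

/-- The complement of a subgraph together with two half-open pieces of the arc of a further edge
separates no more points than the subgraph does. -/
lemma mem_connectedComponentIn_compl_union (hV : G.vertexSet.Finite) (hE : G.edgeSet.Finite)
    (hS : S ⊆ G.edgeSet) {e : β} (he : e ∈ G.edgeSet) (heS : e ∉ S) {s t : I} (hs0 : 0 < s)
    (hst : s < t) (ht1 : t < 1) {p q : TwoSphere}
    (hp : p ∉ f.arc e '' Set.Icc 0 s ∪ f.arc e '' Set.Icc t 1)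
    (hq : q ∉ f.arc e '' Set.Icc 0 s ∪ f.arc e '' Set.Icc t 1)
    (h : q ∈ connectedComponentIn (f.part G.vertexSet S)ᶜ p) :
    q ∈ connectedComponentIn (f.part G.vertexSet S ∪
      (f.arc e '' Set.Icc 0 s ∪ f.arc e '' Set.Icc t 1))ᶜ p := by
  have hKc : IsClosed (f.part G.vertexSet S) := isClosed_part_vertexSet hV hE hS
  have hcl : ∀ a b : I, IsClosed (f.arc e '' Set.Icc a b) := fun a b ↦
    (isCompact_Icc.image (f.arc e).continuous).isClosed
  have hs1 := hst.trans ht1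
  have ht0 := hs0.trans hst
  have hpS : p ∈ (f.part G.vertexSet S)ᶜ := by
    by_contra hp
    simp [connectedComponentIn_eq_empty hp] at h
  have hqS : q ∈ (f.part G.vertexSet S)ᶜ := connectedComponentIn_subset _ _ h
  have hp' := fun h ↦ Or.elim ((Set.mem_union p _ _).1 h) hpS hp
  have hq' := fun h ↦ Or.elim ((Set.mem_union q _ _).1 h) hqS hq
  by_cases hpq : p = q
  · subst hpq
    exact mem_connectedComponentIn hp'
  have hjoin : JoinedIn (f.part G.vertexSet S)ᶜ p q := by
    have hopen : IsOpen (connectedComponentIn (f.part G.vertexSet S)ᶜ p) :=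
      hKc.isOpen_compl.connectedComponentIn
    have hc : _root_.IsConnected (connectedComponentIn (f.part G.vertexSet S)ᶜ p) :=
      isConnected_connectedComponentIn_iff.2 hpS
    exact ((hopen.isConnected_iff_isPathConnected.1 hc).joinedIn p (mem_connectedComponentIn hpS)
      q h).mono (connectedComponentIn_subset _ _)
  -- By the logarithm criterion it suffices to extend a logarithm from the subgraph to the two
  -- pieces; each is an arc that meets the set already treated in at most one point.
  have hlog := TwoSphere.hasLogOn_chart_of_joinedIn hKc hpq hjoin
  have hcont : ∀ K : Set TwoSphere, q ∉ K →
      ContinuousOn (fun z ↦ TwoSphere.chart q z - TwoSphere.chart q p) K := fun K hK ↦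
    ((TwoSphere.continuousOn_chart q).mono fun z hz hzq ↦ hK (hzq ▸ hz)).sub continuousOn_const
  have hne : ∀ K : Set TwoSphere, p ∉ K → q ∉ K →
      ∀ z ∈ K, TwoSphere.chart q z - TwoSphere.chart q p ≠ 0 := fun K hpK hqK z hz h0 ↦
    hpK (TwoSphere.chart_injOn q (fun hzq ↦ hqK (hzq ▸ hz)) hpq (sub_eq_zero.1 h0) ▸ hz)
  rw [Set.mem_union, not_or] at hp hq
  have hlog1 := hasAllLogs_image_Icc_zero (arc_injOn_Ico he) hs0 hs1 _ (hcont _ hq.1)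
    (hne _ hp.1 hq.1)
  have hlog2 := hasAllLogs_image_Icc_one (arc_injOn_Ioc he) ht0 ht1 _ (hcont _ hq.2)
    (hne _ hp.2 hq.2)
  have hoff : ∀ r ∈ Set.Ioo (0 : I) 1, f.arc e r ∉ f.part G.vertexSet S := fun r hr ↦
    Set.disjoint_left.1 (openArc_disjoint_part he subset_rfl hS heS) ⟨r, hr, rfl⟩
  have hlog3 := hlog.union_of_isClosed hlog1 hKc (hcl _ _) <| by
    refine Set.Subsingleton.isPreconnected (Set.Subsingleton.anti
      (Set.subsingleton_singleton (a := f.arc e 0)) ?_)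
    rintro _ ⟨hz, r, hr, rfl⟩
    by_contra hr0
    refine hoff r ⟨lt_of_le_of_ne hr.1 fun h ↦ hr0 (h ▸ rfl), hr.2.trans_lt hs1⟩ hz
  have hlog4 := hlog3.union_of_isClosed hlog2 (hKc.union (hcl _ _)) (hcl _ _) <| by
    refine Set.Subsingleton.isPreconnected (Set.Subsingleton.anti
      (Set.subsingleton_singleton (a := f.arc e 1)) ?_)
    rintro _ ⟨hz, r, hr, rfl⟩
    by_contra hr1
    have hr' : r ∈ Set.Ioo (0 : I) 1 :=
      ⟨ht0.trans_le hr.1, lt_of_le_of_ne hr.2 fun h ↦ hr1 (h ▸ rfl)⟩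
    rcases hz with hz | ⟨r', hr'', h⟩
    · exact hoff r hr' hz
    · have := arc_injOn_Ico he ⟨hr''.1, hr''.2.trans_lt hs1⟩ ⟨hr'.1.le, hr'.2⟩ h
      subst this
      exact absurd (hst.trans_le hr.1) (not_lt.2 hr''.2)
  rw [Set.union_assoc] at hlog4
  exact TwoSphere.mem_connectedComponentIn_of_hasLogOn (hKc.union ((hcl _ _).union (hcl _ _)))
    hp' hq' hpq hlog4

/-- The regions on the two sides of an edge have the whole edge in their boundary. -/
lemma openArc_subset_frontier (hV : G.vertexSet.Finite) (hE : G.edgeSet.Finite) {e : β}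
    (he : e ∈ G.edgeSet) {p : TwoSphere} (hp : p ∈ f.supportᶜ)
    (h : f.openArc e ⊆ connectedComponentIn (f.part G.vertexSet (G.edgeSet \ {e}))ᶜ p) :
    f.openArc e ⊆ frontier (connectedComponentIn f.supportᶜ p) := by
  have hsupp : f.support = f.part G.vertexSet G.edgeSet := support_eq_part
  have hopen : IsOpen f.supportᶜ :=
    (hsupp ▸ isClosed_part_vertexSet hV hE subset_rfl : IsClosed f.support).isOpen_compl
  set F := connectedComponentIn f.supportᶜ p with hF
  have hFo : IsOpen F := hopen.connectedComponentIn
  have hpF : p ∈ F := mem_connectedComponentIn hp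
  have harcsupp : f.openArc e ⊆ f.support := hsupp ▸ openArc_subset_part he
  have harcF : ∀ z ∈ f.openArc e, z ∉ F := fun z hz hzF ↦
    connectedComponentIn_subset _ _ hzF (harcsupp hz)
  rintro _ ⟨r, hr, rfl⟩
  rw [hFo.frontier_eq]
  refine ⟨?_, harcF _ ⟨r, hr, rfl⟩⟩
  -- Otherwise a subarc around `arc e r` avoids the closure of `F`. With a hole `(s, t)` cut into
  -- `e` inside that subarc, `p` and `arc e r` still lie in one component `C` of the complement.
  by_contra hcl
  have hnhds : f.arc e ⁻¹' (closure F)ᶜ ∩ Set.Ioo 0 1 ∈ nhds r :=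
    Filter.inter_mem ((f.arc e).continuous.continuousAt.preimage_mem_nhds
      (isClosed_closure.isOpen_compl.mem_nhds hcl)) (isOpen_Ioo.mem_nhds hr)
  obtain ⟨a, b, hab, hIoo⟩ := (mem_nhds_iff_exists_Ioo_subset' ⟨0, hr.1⟩ ⟨1, hr.2⟩).1 hnhds
  obtain ⟨s, has, hsr⟩ := exists_between hab.1
  obtain ⟨t, hrt, htb⟩ := exists_between hab.2
  have hs := hIoo ⟨has, hsr.trans hab.2⟩
  have ht := hIoo ⟨hab.1.trans hrt, htb⟩
  have hparc : ∀ z ∈ Set.range (f.arc e), z ≠ p := by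
    rintro z hz rfl
    exact hp (hsupp ▸ (range_arc_subset he).trans
      (part_mono subset_rfl (Set.singleton_subset_iff.2 he)) hz)
  have hmem := mem_connectedComponentIn_compl_union hV hE Set.sdiff_subset he
    (fun h : e ∈ G.edgeSet \ {e} ↦ h.2 rfl) hs.2.1 (hsr.trans hrt) ht.2.2 (p := p)
    (q := f.arc e r) ?_ ?_ (h ⟨r, hr, rfl⟩)
  · set C := connectedComponentIn (f.part G.vertexSet (G.edgeSet \ {e}) ∪
      (f.arc e '' Set.Icc 0 s ∪ f.arc e '' Set.Icc t 1))ᶜ p with hC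
    -- The frontier of `F` lies on the graph, and `C` meets the graph only in the hole, away from
    -- the closure of `F`. Being connected, `C` lies in `F`, which is absurd for `arc e r`.
    have hCcov : C ⊆ F ∪ (closure F)ᶜ := by
      intro z hz
      by_contra hcon
      rw [Set.mem_union, not_or, Set.notMem_compl_iff] at hcon
      have hzfr : z ∈ frontier F := hFo.frontier_eq ▸ ⟨hcon.2, hcon.1⟩
      have hzs : z ∈ f.support := by
        simpa using frontier_connectedComponentIn_subset hopen p hzfr
      have hzC := connectedComponentIn_subset _ _ hz
      rw [Set.mem_compl_iff, Set.mem_union, Set.mem_union, not_or, not_or] at hzC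
      rw [hsupp, mem_part] at hzs
      rcases hzs with ⟨v, hv, rfl⟩ | ⟨e', he', hz'⟩
      · exact hzC.1 (point_mem_part hv)
      · by_cases hee : e' = e
        · subst hee
          obtain ⟨r', hr', rfl⟩ := hz'
          have h1 : s < r' := by
            by_contra! h1
            exact hzC.2.1 ⟨r', ⟨hr'.1.le, h1⟩, rfl⟩
          have h2 : r' < t := by
            by_contra! h2
            exact hzC.2.2 ⟨r', ⟨h2, hr'.2.le⟩, rfl⟩
          exact (hIoo ⟨has.trans h1, h2.trans htb⟩).1 hcon.2
        · exact hzC.1 (openArc_subset_part (S := G.edgeSet \ {e}) ⟨he', hee⟩ hz')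
    have hCF := isPreconnected_connectedComponentIn.subset_left_of_subset_union hFo
      isClosed_closure.isOpen_compl
      (Set.disjoint_left.2 fun z hz hz' ↦ hz' (subset_closure hz)) hCcov
      ⟨p, mem_connectedComponentIn ?_, hpF⟩
    · exact harcF (f.arc e r) ⟨r, hr, rfl⟩ (hCF hmem)
    · by_contra hcon
      rw [hC, connectedComponentIn_eq_empty hcon] at hmem
      exact hmem
  · rintro (⟨r', -, h⟩ | ⟨r', -, h⟩) <;> exact hparc _ ⟨r', rfl⟩ h
  · rintro (⟨r', hr', h⟩ | ⟨r', hr', h⟩)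
    · have := arc_injOn_Ico he ⟨hr'.1, hr'.2.trans_lt hs.2.2⟩ ⟨hr.1.le, hr.2⟩ h
      subst this
      exact absurd hsr (not_lt.2 hr'.2)
    · have := arc_injOn_Ioc he ⟨ht.2.1.trans_le hr'.1, hr'.2⟩ ⟨hr.1, hr.2.le⟩ h
      subst this
      exact absurd hrt (not_lt.2 hr'.1)

end Graph.SphereEmbedding

/-!
### Spanning trees of the dual graph
-/

namespace Graph.SphereEmbedding

variable {α β α' β' : Type*} {G : Graph α β} {f : G.SphereEmbedding} {G' : Graph α' β'}

/-- The data of a duality: a bijection of the vertices of `G'` with the regions of `f` and a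
bijection of the edges. -/
structure DualData (f : G.SphereEmbedding) (G' : Graph α' β') where
  /-- The region of a vertex of the dual graph. -/
  region : α' → Set TwoSphere
  /-- The edge of the dual graph that crosses a given edge. -/
  dualEdge : β → β'
  region_bijOn : Set.BijOn region G'.vertexSet f.regions
  dualEdge_bijOn : Set.BijOn dualEdge G.edgeSet G'.edgeSet
  ends : ∀ e ∈ G.edgeSet, ∀ x y, G'.IsLink (dualEdge e) x y →
    {F ∈ f.regions | f.openArc e ⊆ frontier F} = {region x, region y}

namespace DualData

variable (D : f.DualData G')

variable {D} {S : Set β}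

lemma exists_region_eq {r : α'} (hr : r ∈ G'.vertexSet) :
    ∃ p ∈ f.supportᶜ, p ∈ D.region r ∧ D.region r = connectedComponentIn f.supportᶜ p := by
  obtain ⟨p, hp, h⟩ := D.region_bijOn.mapsTo hr
  exact ⟨p, hp, h ▸ mem_connectedComponentIn hp, h⟩

lemma isPreconnected_region {r : α'} (hr : r ∈ G'.vertexSet) : IsPreconnected (D.region r) := by
  obtain ⟨p, hp, -, h⟩ := D.exists_region_eq hr
  exact h ▸ isPreconnected_connectedComponentIn

lemma region_subset {r : α'} (hr : r ∈ G'.vertexSet) : D.region r ⊆ f.supportᶜ := by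
  obtain ⟨p, hp, -, h⟩ := D.exists_region_eq hr
  exact h ▸ connectedComponentIn_subset _ _

lemma exists_mem_region {z : TwoSphere} (hz : z ∈ f.supportᶜ) :
    ∃ r ∈ G'.vertexSet, z ∈ D.region r ∧ D.region r = connectedComponentIn f.supportᶜ z := by
  obtain ⟨r, hr, h⟩ := D.region_bijOn.surjOn ⟨z, hz, rfl⟩
  exact ⟨r, hr, h ▸ mem_connectedComponentIn hz, h⟩

lemma eq_of_mem_region {r r' : α'} (hr : r ∈ G'.vertexSet) (hr' : r' ∈ G'.vertexSet)
    {z : TwoSphere} (hz : z ∈ D.region r) (hz' : z ∈ D.region r') : r = r' := by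
  obtain ⟨p, hp, -, h⟩ := D.exists_region_eq hr
  obtain ⟨p', hp', -, h'⟩ := D.exists_region_eq hr'
  refine D.region_bijOn.injOn hr hr' ?_
  rw [h] at hz
  rw [h'] at hz'
  rw [h, h', connectedComponentIn_eq hz, connectedComponentIn_eq hz']

lemma openArc_subset_frontier_region {e : β} (he : e ∈ G.edgeSet) {x y : α'}
    (h : G'.IsLink (D.dualEdge e) x y) : f.openArc e ⊆ frontier (D.region x) := by
  have : D.region x ∈ {F ∈ f.regions | f.openArc e ⊆ frontier F} := by
    rw [D.ends e he x y h]
    exact Or.inl rfl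
  exact this.2

lemma isOpen_compl_support (hV : G.vertexSet.Finite) (hE : G.edgeSet.Finite) :
    IsOpen f.supportᶜ :=
  (support_eq_part (f := f) ▸ isClosed_part_vertexSet hV hE subset_rfl : IsClosed f.support)
    |>.isOpen_compl

lemma isOpen_region (hV : G.vertexSet.Finite) (hE : G.edgeSet.Finite) {r : α'}
    (hr : r ∈ G'.vertexSet) : IsOpen (D.region r) := by
  obtain ⟨p, hp, -, h⟩ := D.exists_region_eq hr
  exact h ▸ (isOpen_compl_support hV hE).connectedComponentIn

/-- A neighbourhood of the open arc of an edge meets only the regions on both sides. -/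
lemma exists_nhd_openArc (hV : G.vertexSet.Finite) (hE : G.edgeSet.Finite) {e : β}
    (he : e ∈ G.edgeSet) : ∃ W : Set TwoSphere, IsOpen W ∧ f.openArc e ⊆ W ∧
      W ⊆ (f.part G.vertexSet (G.edgeSet \ {e}))ᶜ ∧
      ∀ x y, G'.IsLink (D.dualEdge e) x y → ∀ z ∈ W, z ∈ f.supportᶜ →
        z ∈ D.region x ∨ z ∈ D.region y := by
  obtain ⟨s, hs⟩ := exists_between (zero_lt_one (α := I))
  have hsub : f.openArc e ⊆ (f.part G.vertexSet (G.edgeSet \ {e}))ᶜ :=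
    Set.disjoint_left.1 (openArc_disjoint_part he subset_rfl Set.sdiff_subset fun h ↦ h.2 rfl)
  have hpre : IsPreconnected (f.openArc e) :=
    isPreconnected_Ioo.image _ (f.arc e).continuous.continuousOn
  -- `W` is the region that arises around the arc when `e` is deleted. Every region of `f` inside it
  -- has `e` in its frontier, so duality makes it one of the two ends.
  refine ⟨connectedComponentIn (f.part G.vertexSet (G.edgeSet \ {e}))ᶜ (f.arc e s),
    (isClosed_part_vertexSet hV hE Set.sdiff_subset).isOpen_compl.connectedComponentIn,
    hpre.subset_connectedComponentIn ⟨s, hs, rfl⟩ hsub, connectedComponentIn_subset _ _,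
    fun x y hxy z hz hzs ↦ ?_⟩
  have h1 := openArc_subset_frontier hV hE he hzs
    (connectedComponentIn_eq hz ▸ hpre.subset_connectedComponentIn ⟨s, hs, rfl⟩ hsub)
  have h2 : connectedComponentIn f.supportᶜ z ∈ {F ∈ f.regions | f.openArc e ⊆ frontier F} :=
    ⟨⟨z, hzs, rfl⟩, h1⟩
  have h3 := mem_connectedComponentIn hzs
  rw [D.ends e he x y hxy] at h2
  rcases h2 with h2 | h2
  · exact Or.inl (h2 ▸ h3)
  · exact Or.inr ((show _ = _ from h2) ▸ h3)

lemma mem_compl_part_iff (hS : S ⊆ G.edgeSet) {z : TwoSphere} :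
    z ∈ (f.part G.vertexSet S)ᶜ ↔ z ∈ f.supportᶜ ∨ ∃ e ∈ G.edgeSet \ S, z ∈ f.openArc e := by
  rw [Set.mem_compl_iff, Set.mem_compl_iff, support_eq_part]
  constructor
  · intro hz
    by_cases h : z ∈ f.part G.vertexSet G.edgeSet
    · rcases mem_part.1 h with ⟨v, hv, rfl⟩ | ⟨e, he, hze⟩
      · exact absurd (point_mem_part hv) hz
      · exact Or.inr ⟨e, ⟨he, fun h ↦ hz (openArc_subset_part h hze)⟩, hze⟩
    · exact Or.inl h
  · rintro (h | ⟨e, he, hze⟩) hz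
    · exact h (part_mono subset_rfl hS hz)
    · exact Set.disjoint_left.1 (openArc_disjoint_part he.1 subset_rfl hS he.2) hze hz

lemma openArc_subset_support {e : β} (he : e ∈ G.edgeSet) : f.openArc e ⊆ f.support :=
  support_eq_part (f := f) ▸ openArc_subset_part he

/-- A region together with an open arc in its frontier is connected, so a walk in the dual graph
gives a connected chain of regions glued along the arcs crossed. -/
lemma isConnected_compl_part (hS : S ⊆ G.edgeSet)
    (h : (G'.restrict (D.dualEdge '' (G.edgeSet \ S))).IsConnected) :
    _root_.IsConnected (f.part G.vertexSet S)ᶜ := by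
  obtain ⟨⟨r₀, hr₀⟩, h⟩ := h
  obtain ⟨p, hp, hpr, -⟩ := D.exists_region_eq hr₀
  have hsub : ∀ r ∈ G'.vertexSet, D.region r ⊆ (f.part G.vertexSet S)ᶜ := fun r hr z hz ↦
    (mem_compl_part_iff hS).2 (Or.inl (D.region_subset hr hz))
  have key : ∀ e ∈ G.edgeSet \ S, ∀ x y, G'.IsLink (D.dualEdge e) x y →
      IsPreconnected (D.region x ∪ f.openArc e) := fun e he x y hxy ↦
    (D.isPreconnected_region hxy.left_mem).subset_closure Set.subset_union_left
      (Set.union_subset subset_closure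
        ((openArc_subset_frontier_region he.1 hxy).trans frontier_subset_closure))
  have hjoin : ∀ r, G'.JoinedBy (D.dualEdge '' (G.edgeSet \ S)) r₀ r →
      ∃ t ⊆ (f.part G.vertexSet S)ᶜ, D.region r₀ ⊆ t ∧ D.region r ⊆ t ∧ IsPreconnected t := by
    intro r hr
    induction hr with
    | refl => exact ⟨D.region r₀, hsub _ hr₀, subset_rfl, subset_rfl, D.isPreconnected_region hr₀⟩
    | @tail b c _ hbc ih =>
      obtain ⟨t, ht, h0, h1, htc⟩ := ih
      obtain ⟨_, ⟨e, he, rfl⟩, hbc⟩ := restrict_adj_iff.1 hbc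
      obtain ⟨q, -, hq, -⟩ := D.exists_region_eq hbc.left_mem
      obtain ⟨s, hs⟩ := exists_between (zero_lt_one (α := I))
      have hs : f.arc e s ∈ f.openArc e := ⟨s, hs, rfl⟩
      refine ⟨t ∪ ((D.region b ∪ f.openArc e) ∪ (D.region c ∪ f.openArc e)), ?_,
        h0.trans Set.subset_union_left, fun z hz ↦ Or.inr (Or.inr (Or.inl hz)), ?_⟩
      · have harc : f.openArc e ⊆ (f.part G.vertexSet S)ᶜ := fun z hz ↦
          (mem_compl_part_iff hS).2 (Or.inr ⟨e, he, hz⟩)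
        exact Set.union_subset ht (Set.union_subset
          (Set.union_subset (hsub _ hbc.left_mem) harc)
          (Set.union_subset (hsub _ hbc.right_mem) harc))
      · exact htc.union q (h1 hq) (Or.inl (Or.inl hq))
          ((key e he b c hbc).union _ (Or.inr hs) (Or.inr hs) (key e he c b hbc.symm))
  refine ⟨⟨p, hsub r₀ hr₀ hpr⟩, isPreconnected_of_forall p fun z hz ↦ ?_⟩
  rcases (mem_compl_part_iff hS).1 hz with hz | ⟨e, he, hze⟩
  · obtain ⟨r, hr, hzr, -⟩ := D.exists_mem_region hz
    obtain ⟨t, ht, h0, h1, htc⟩ := hjoin r (h r₀ hr₀ r hr)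
    exact ⟨t, ht, h0 hpr, h1 hzr, htc⟩
  · obtain ⟨x, y, hxy⟩ := exists_isLink_of_mem_edgeSet (D.dualEdge_bijOn.mapsTo he.1)
    obtain ⟨t, ht, h0, h1, htc⟩ := hjoin x (h r₀ hr₀ x hxy.left_mem)
    obtain ⟨q, -, hq, -⟩ := D.exists_region_eq hxy.left_mem
    refine ⟨t ∪ (D.region x ∪ f.openArc e), Set.union_subset ht (Set.union_subset
      (hsub _ hxy.left_mem) fun z hz ↦ (mem_compl_part_iff hS).2 (Or.inr ⟨e, he, hz⟩)),
      Or.inl (h0 hpr), Or.inr (Or.inr hze),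
      htc.union q (h1 hq) (Or.inl hq) (key e he x y hxy)⟩

/-- If `r₀` and `r₁` were not joined, the regions joined to `r₀` and all others, each family
enlarged by neighbourhoods of the arcs between its members, would split the complement into two open
parts. -/
lemma isConnected_restrict_dual (hV : G.vertexSet.Finite) (hE : G.edgeSet.Finite)
    (hne : G'.vertexSet.Nonempty) (hS : S ⊆ G.edgeSet)
    (h : IsPreconnected (f.part G.vertexSet S)ᶜ) :
    (G'.restrict (D.dualEdge '' (G.edgeSet \ S))).IsConnected := by
  refine ⟨hne, fun (r₀ : α') (hr₀ : r₀ ∈ G'.vertexSet) (r₁ : α') (hr₁ : r₁ ∈ G'.vertexSet) ↦ ?_⟩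
  choose! W hWo hWarc hWsub hW using fun e (he : e ∈ G.edgeSet) ↦
    D.exists_nhd_openArc hV hE he
  let A : Set α' := {r ∈ G'.vertexSet | G'.JoinedBy (D.dualEdge '' (G.edgeSet \ S)) r₀ r}
  -- the part of the complement that consists of the given regions and the edges between them
  let N : Set α' → Set TwoSphere := fun A ↦ (⋃ r ∈ A, D.region r) ∪
    ⋃ e ∈ {e ∈ G.edgeSet \ S | ∀ x y, G'.IsLink (D.dualEdge e) x y → x ∈ A}, W e
  have hNo : ∀ A ⊆ G'.vertexSet, IsOpen (N A) := fun A hA ↦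
    (isOpen_biUnion fun r hr ↦ D.isOpen_region hV hE (hA hr)).union
      (isOpen_biUnion fun e he ↦ hWo e he.1.1)
  have hNreg : ∀ A ⊆ G'.vertexSet, ∀ z ∈ N A, z ∈ f.supportᶜ → ∃ r ∈ A, z ∈ D.region r := by
    rintro A hA z (hz | hz) hzs
    · simpa using hz
    · obtain ⟨e, he, hz⟩ := Set.mem_iUnion₂.1 hz
      obtain ⟨x, y, hxy⟩ := exists_isLink_of_mem_edgeSet (D.dualEdge_bijOn.mapsTo he.1.1)
      rcases hW e he.1.1 x y hxy z hz hzs with h | h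
      · exact ⟨x, he.2 x y hxy, h⟩
      · exact ⟨y, he.2 y x hxy.symm, h⟩
  have hNarc : ∀ A ⊆ G'.vertexSet, ∀ e ∈ G.edgeSet, ∀ z ∈ N A, z ∈ f.openArc e →
      ∀ x y, G'.IsLink (D.dualEdge e) x y → x ∈ A := by
    rintro A hA e he z (hz | hz) hze
    · obtain ⟨r, hr, hz⟩ := Set.mem_iUnion₂.1 hz
      exact absurd (openArc_subset_support he hze) (D.region_subset (hA hr) hz)
    · obtain ⟨e', he', hz⟩ := Set.mem_iUnion₂.1 hz
      obtain rfl : e = e' := by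
        by_contra hee
        exact hWsub e' he'.1.1 hz (openArc_subset_part (S := G.edgeSet \ {e'}) ⟨he, hee⟩ hze)
      exact he'.2
  have hAV : A ⊆ G'.vertexSet := fun r hr ↦ hr.1
  have hBV : G'.vertexSet \ A ⊆ G'.vertexSet := Set.sdiff_subset
  have hAadj : ∀ e ∈ G.edgeSet \ S, ∀ x y, G'.IsLink (D.dualEdge e) x y → x ∈ A → y ∈ A :=
    fun e he x y hxy hx ↦ ⟨hxy.right_mem, hx.2.trans (.of_isLink ⟨e, he, rfl⟩ hxy)⟩
  have hcov : (f.part G.vertexSet S)ᶜ ⊆ N A ∪ N (G'.vertexSet \ A) := by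
    intro z hz
    rcases (mem_compl_part_iff hS).1 hz with hz | ⟨e, he, hze⟩
    · obtain ⟨r, hr, hzr, -⟩ := D.exists_mem_region hz
      by_cases hrA : r ∈ A
      · exact Or.inl (Or.inl (Set.mem_biUnion hrA hzr))
      · exact Or.inr (Or.inl (Set.mem_biUnion (⟨hr, hrA⟩ : r ∈ G'.vertexSet \ A) hzr))
    · obtain ⟨x, y, hxy⟩ := exists_isLink_of_mem_edgeSet (D.dualEdge_bijOn.mapsTo he.1)
      by_cases hxA : x ∈ A
      · refine Or.inl (Or.inr (Set.mem_biUnion (x := e) ⟨he, fun x' y' h' ↦ ?_⟩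
          (hWarc e he.1 hze)))
        rcases h'.eq_and_eq_or_eq_and_eq hxy with ⟨rfl, rfl⟩ | ⟨rfl, rfl⟩
        · exact hxA
        · exact hAadj e he _ _ hxy hxA
      · refine Or.inr (Or.inr (Set.mem_biUnion (x := e) ⟨he, fun x' y' h' ↦ ⟨h'.left_mem, ?_⟩⟩
          (hWarc e he.1 hze)))
        rcases h'.eq_and_eq_or_eq_and_eq hxy with ⟨rfl, rfl⟩ | ⟨rfl, rfl⟩
        · exact hxA
        · exact fun h ↦ hxA (hAadj e he _ _ hxy.symm h)
  have hdisj : (f.part G.vertexSet S)ᶜ ∩ (N A ∩ N (G'.vertexSet \ A)) = ∅ := by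
    refine Set.eq_empty_of_forall_notMem ?_
    rintro z ⟨hz, hzA, hzB⟩
    rcases (mem_compl_part_iff hS).1 hz with hz | ⟨e, he, hze⟩
    · obtain ⟨r, hr, hzr⟩ := hNreg A hAV z hzA hz
      obtain ⟨r', hr', hzr'⟩ := hNreg _ hBV z hzB hz
      exact hr'.2 (D.eq_of_mem_region hr.1 hr'.1 hzr hzr' ▸ hr)
    · obtain ⟨x, y, hxy⟩ := exists_isLink_of_mem_edgeSet (D.dualEdge_bijOn.mapsTo he.1)
      exact (hNarc _ hBV e he.1 z hzB hze x y hxy).2 (hNarc A hAV e he.1 z hzA hze x y hxy)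
  have hr₀A : r₀ ∈ A := ⟨hr₀, .refl _ _⟩
  by_contra hr₁A
  have hr₁B : r₁ ∈ G'.vertexSet \ A := ⟨hr₁, fun h ↦ hr₁A h.2⟩
  have hmeet : ∀ A : Set α', ∀ r ∈ G'.vertexSet, r ∈ A →
      ((f.part G.vertexSet S)ᶜ ∩ N A).Nonempty := by
    intro A r hrV hr
    obtain ⟨p, hp, hpr, -⟩ := D.exists_region_eq hrV
    exact ⟨p, (mem_compl_part_iff hS).2 (Or.inl hp), Or.inl (Set.mem_biUnion hr hpr)⟩
  exact (h _ _ (hNo A hAV) (hNo _ hBV) hcov (hmeet A r₀ hr₀ hr₀A)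
    (hmeet _ r₁ hr₁ hr₁B)).ne_empty hdisj

/-- The complement of a spanning tree is a spanning tree of the dual graph, and conversely. -/
theorem isTree_dual_iff (hG : G.IsConnected) (hE : G.edgeSet.Finite)
    (hne : G'.vertexSet.Nonempty) (hS : S ⊆ G.edgeSet) :
    (G.restrict S).IsTree ↔ (G'.restrict (D.dualEdge '' (G.edgeSet \ S))).IsTree := by
  have hV := hG.finite_vertexSet hE
  have hsub : D.dualEdge '' (G.edgeSet \ S) ⊆ G'.edgeSet :=
    (Set.image_mono Set.sdiff_subset).trans D.dualEdge_bijOn.image_eq.subset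
  -- Deleting the dual of `e` from the complementary set amounts to adding `e` to `S`. Minimality of
  -- the dual set thus concerns `insert e S`, which separates the sphere when the ends of `e` are
  -- already joined by `S`.
  have hdiff : ∀ e ∈ G.edgeSet, D.dualEdge '' (G.edgeSet \ S) \ {D.dualEdge e} =
      D.dualEdge '' (G.edgeSet \ insert e S) := by
    intro e he
    refine Set.Subset.antisymm ?_ ?_
    · rintro _ ⟨⟨e', he', rfl⟩, hne⟩
      refine ⟨e', ⟨he'.1, ?_⟩, rfl⟩
      rintro (rfl | h)
      · exact hne rfl
      · exact he'.2 h
    · rintro _ ⟨e', he', rfl⟩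
      refine ⟨⟨e', ⟨he'.1, fun h ↦ he'.2 (Or.inr h)⟩, rfl⟩, fun h ↦ he'.2 (Or.inl ?_)⟩
      exact D.dualEdge_bijOn.injOn he'.1 he h
  rw [isTree_restrict_iff' hsub, isTree_restrict_iff]
  constructor
  · rintro ⟨hc, hf⟩
    refine ⟨isConnected_restrict_dual hV hE hne hS
      ((hasAllLogs_part_of_isForestSet hV hE hS hf).isPreconnected_compl
        (isClosed_part_vertexSet hV hE hS)), ?_⟩
    rintro _ ⟨e, he, rfl⟩ hc'
    rw [hdiff e he.1] at hc'
    have hS' := Set.insert_subset he.1 hS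
    obtain ⟨x, y, hxy⟩ := exists_isLink_of_mem_edgeSet he.1
    refine not_isConnected_compl_part hV hE hS' (Set.mem_insert e S) hxy ?_
      (D.isConnected_compl_part hS' hc')
    rw [Set.insert_sdiff_self_of_notMem he.2]
    exact hc.2 x hxy.left_mem y hxy.right_mem
  · rintro ⟨hc, hf⟩
    have hforest : G.IsForestSet S := fun e he x y hxy hj ↦
      not_isConnected_compl_part hV hE hS he hxy hj (D.isConnected_compl_part hS hc)
    refine ⟨?_, hforest⟩
    by_contra hcon
    -- If the forest `S` were not connected, `insert e S` would still carry all logarithms and not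
    -- separate the sphere, so the dual of `e` would be dispensable.
    obtain ⟨e, he, x, y, hxy, hj⟩ := hG.exists_not_joinedBy hcon
    have heS : e ∉ S := fun h ↦ hj (.of_isLink h hxy)
    refine hf _ ⟨e, ⟨he, heS⟩, rfl⟩ ?_
    rw [hdiff e he]
    have hS' := Set.insert_subset he hS
    exact isConnected_restrict_dual hV hE hne hS'
      ((HasAllLogs.part_insert hV hE hS hxy hj (hasAllLogs_part_of_isForestSet hV hE hS
        hforest)).isPreconnected_compl (isClosed_part_vertexSet hV hE hS'))

end DualData

end Graph.SphereEmbedding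

/-!
### The Cremona transformation of the torus in projective space
-/

namespace ProjSpace

open MvPolynomial HomogeneousLocalization

attribute [local instance] MvPolynomial.gradedAlgebra

variable (K : Type*) [Field K] (n : ℕ)

/-- The product of the coordinates. -/
noncomputable abbrev coordProd : MvPolynomial (Fin n) K := ∏ i, X i

lemma coordProd_mem : coordProd K n ∈ homogeneousSubmodule (Fin n) K n := by
  have := IsHomogeneous.prod Finset.univ (fun i : Fin n ↦ (X i : MvPolynomial (Fin n) K))
    (fun _ ↦ 1) (fun i _ ↦ isHomogeneous_X K i)
  simpa using this

/-- The coordinate ring of the affine torus. -/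
abbrev TorusRing : Type _ := Localization.Away (coordProd K n)

/-- The coordinates as units on the torus. -/
noncomputable def coordUnit (i : Fin n) : (TorusRing K n)ˣ :=
  (isUnit_of_dvd_unit (map_dvd (algebraMap (MvPolynomial (Fin n) K) (TorusRing K n))
    (Finset.dvd_prod_of_mem _ (Finset.mem_univ i)))
    (IsLocalization.Away.algebraMap_isUnit (coordProd K n))).unit

variable {K n}

@[simp]
lemma coe_coordUnit (i : Fin n) :
    (coordUnit K n i : TorusRing K n) = algebraMap (MvPolynomial (Fin n) K) _ (X i) := rfl

lemma coe_prod_coordUnit :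
    ((∏ i, coordUnit K n i : (TorusRing K n)ˣ) : TorusRing K n) =
      algebraMap (MvPolynomial (Fin n) K) _ (coordProd K n) := by
  simp [map_prod]

/-- The substitution `X i ↦ X (π i)⁻¹`. -/
noncomputable def invSubst (π : Equiv.Perm (Fin n)) :
    MvPolynomial (Fin n) K →ₐ[K] TorusRing K n :=
  aeval fun i ↦ (((coordUnit K n (π i))⁻¹ : (TorusRing K n)ˣ) : TorusRing K n)

lemma invSubst_X (π : Equiv.Perm (Fin n)) (i : Fin n) : invSubst (K := K) π (X i) =
    (((coordUnit K n (π i))⁻¹ : (TorusRing K n)ˣ) : TorusRing K n) := aeval_X _ _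

lemma invSubst_coordProd (π : Equiv.Perm (Fin n)) : invSubst π (coordProd K n) =
    (((∏ i, coordUnit K n i)⁻¹ : (TorusRing K n)ˣ) : TorusRing K n) := by
  rw [map_prod, ← Equiv.prod_comp π (coordUnit K n), ← Finset.prod_inv_distrib, Units.coe_prod]
  exact Finset.prod_congr rfl fun i _ ↦ invSubst_X π i

/-- The Cremona transformation of the affine torus, composed with a permutation of the
coordinates. -/
noncomputable def cremona (π : Equiv.Perm (Fin n)) : TorusRing K n →+* TorusRing K n :=
  IsLocalization.Away.lift (coordProd K n) (g := (invSubst (K := K) π).toRingHom)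
    (by
      change IsUnit (invSubst π (coordProd K n))
      rw [invSubst_coordProd]
      exact Units.isUnit _)

lemma cremona_algebraMap (π : Equiv.Perm (Fin n)) (p : MvPolynomial (Fin n) K) :
    cremona π (algebraMap _ _ p) = invSubst π p :=
  IsLocalization.Away.lift_eq _ _ _

lemma cremona_coordUnit (π : Equiv.Perm (Fin n)) (i : Fin n) :
    Units.map (cremona (K := K) π : TorusRing K n →* TorusRing K n) (coordUnit K n i) =
      (coordUnit K n (π i))⁻¹ := by
  ext
  simp [cremona_algebraMap, invSubst_X]

lemma cremona_prod_coordUnit (π : Equiv.Perm (Fin n)) :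
    Units.map (cremona (K := K) π : TorusRing K n →* TorusRing K n) (∏ i, coordUnit K n i) =
      (∏ i, coordUnit K n i)⁻¹ := by
  rw [map_prod, ← Finset.prod_inv_distrib, ← Equiv.prod_comp π fun i ↦ (coordUnit K n i)⁻¹]
  exact Finset.prod_congr rfl fun i _ ↦ cremona_coordUnit π i

lemma cremona_prod_coordUnit_pow (π : Equiv.Perm (Fin n)) (k : ℕ) :
    cremona π (((∏ i, coordUnit K n i)⁻¹ ^ k : (TorusRing K n)ˣ) : TorusRing K n) =
      (((∏ i, coordUnit K n i) ^ k : (TorusRing K n)ˣ) : TorusRing K n) := by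
  have h := congrArg (fun u ↦ ((u⁻¹ ^ k : (TorusRing K n)ˣ) : TorusRing K n))
    (cremona_prod_coordUnit (K := K) π)
  simp only [inv_inv, ← map_inv, ← map_pow] at h
  exact h

lemma invSubst_C (π : Equiv.Perm (Fin n)) (c : K) :
    invSubst (K := K) π (C c) = algebraMap (MvPolynomial (Fin n) K) _ (C c) :=
  ((invSubst π).commutes c).trans (IsScalarTower.algebraMap_apply K (MvPolynomial (Fin n) K) _ c)

lemma cremona_comp_cremona_symm (π : Equiv.Perm (Fin n)) :
    (cremona (K := K) π.symm).comp (cremona π) = RingHom.id _ := by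
  refine IsLocalization.ringHom_ext (Submonoid.powers (coordProd K n)) ?_
  refine MvPolynomial.ringHom_ext (fun r ↦ ?_) fun i ↦ ?_
  · simp only [RingHom.comp_apply, cremona_algebraMap, RingHom.id_apply]
    rw [invSubst_C, cremona_algebraMap, invSubst_C]
  · have h1 := congrArg (Units.map (cremona (K := K) π.symm : TorusRing K n →* TorusRing K n))
      (cremona_coordUnit (K := K) π i)
    rw [map_inv, cremona_coordUnit π.symm, inv_inv, Equiv.symm_apply_apply] at h1
    exact congrArg Units.val h1

/-! ### Elements of degree zero and the torus in projective space -/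

/-- The coordinate ring of the torus in projective space. -/
abbrev ProjTorusRing (K : Type*) [Field K] (n : ℕ) : Type _ :=
  Away (homogeneousSubmodule (Fin n) K) (coordProd K n)

lemma val_mk_eq (k : ℕ) (p : MvPolynomial (Fin n) K)
    (hp : p ∈ homogeneousSubmodule (Fin n) K (k • n)) :
    (Away.mk _ (coordProd_mem K n) k p hp).val = algebraMap _ (TorusRing K n) p *
      (((∏ i, coordUnit K n i)⁻¹ ^ k : (TorusRing K n)ˣ) : TorusRing K n) := by
  rw [Away.val_mk, Localization.mk_eq_mk'_apply, IsLocalization.mk'_eq_iff_eq_mul, mul_assoc]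
  simp only [map_pow, ← coe_prod_coordUnit, ← Units.val_pow_eq_pow_val, ← Units.val_mul]
  simp

/-- Inversion turns degree `k * n` into `-k * n`, which `k` factors of the coordinate product
compensate. This is made explicit for each monomial. -/
lemma exists_val_eq_invSubst (π : Equiv.Perm (Fin n)) (k : ℕ) (p : MvPolynomial (Fin n) K)
    (hp : p ∈ homogeneousSubmodule (Fin n) K (k • n)) :
    ∃ b : ProjTorusRing K n, b.val = invSubst π p *
      (((∏ i, coordUnit K n i) ^ k : (TorusRing K n)ˣ) : TorusRing K n) := by
  classical
  suffices h : ∀ m ∈ p.support, ∃ b : ProjTorusRing K n,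
      b.val = invSubst π (monomial m (p.coeff m)) *
        (((∏ i, coordUnit K n i) ^ k : (TorusRing K n)ˣ) : TorusRing K n) by
    choose! b hb using h
    refine ⟨∑ m ∈ p.support, b m, ?_⟩
    have : (∑ m ∈ p.support, b m).val = ∑ m ∈ p.support, (b m).val :=
      map_sum (algebraMap (ProjTorusRing K n) (TorusRing K n)) _ _
    conv_rhs => rw [p.as_sum, map_sum, Finset.sum_mul]
    rw [this]
    exact Finset.sum_congr rfl hb
  intro m hm
  have hdeg : ∑ i, m i = k * n := by
    have := hp (mem_support_iff.1 hm)
    rw [Finsupp.weight_apply, Finsupp.sum_fintype _ _ (by simp)] at this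
    simpa using this
  have hle : ∀ i, m i ≤ k * n := fun i ↦ hdeg ▸ Finset.single_le_sum (f := fun i ↦ m i)
    (fun _ _ ↦ Nat.zero_le _) (Finset.mem_univ i)
  set U := ∏ i, coordUnit K n i with hU
  -- No exponent exceeds the degree `k * n`, so the power `U ^ (k * n)` is a common denominator for
  -- all inverted monomials.
  have hunit : (∏ i, coordUnit K n (π i) ^ (k * n - m i)) * U⁻¹ ^ (k * n) =
      ∏ i, ((coordUnit K n (π i))⁻¹) ^ m i := by
    rw [hU, ← Equiv.prod_comp π (coordUnit K n), ← Finset.prod_inv_distrib, ← Finset.prod_pow,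
      ← Finset.prod_mul_distrib]
    refine Finset.prod_congr rfl fun i _ ↦ ?_
    rw [inv_pow, inv_pow, mul_inv_eq_iff_eq_mul, eq_inv_mul_iff_mul_eq, ← pow_add,
      Nat.add_sub_cancel' (hle i)]
  have hq : C (p.coeff m) * (∏ i, X (π i) ^ (k * n - m i)) * coordProd K n ^ k ∈
      homogeneousSubmodule (Fin n) K ((k * n) • n) := by
    have h1 : (∏ i, X (π i) ^ (k * n - m i) : MvPolynomial (Fin n) K).IsHomogeneous
        (∑ i, (k * n - m i)) :=
      IsHomogeneous.prod _ _ _ fun i _ ↦ by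
        simpa using (isHomogeneous_X K (π i)).pow (k * n - m i)
    have h2 := ((isHomogeneous_C (Fin n) (p.coeff m)).mul h1).mul
      (IsHomogeneous.pow (coordProd_mem K n) k)
    have h3 : ∑ i, (k * n - m i) + k * n = k * n * n := by
      rw [← hdeg, ← Finset.sum_add_distrib, hdeg, Finset.sum_congr rfl fun i _ ↦
        Nat.sub_add_cancel (hle i)]
      simp [mul_comm]
    rw [mem_homogeneousSubmodule]
    convert h2 using 1
    rw [zero_add, mul_comm n k, h3, smul_eq_mul]
  refine ⟨Away.mk _ (coordProd_mem K n) (k * n) _ hq, ?_⟩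
  have h4 := congrArg Units.val hunit
  simp only [Units.val_mul, Units.coe_prod, Units.val_pow_eq_pow_val, coe_coordUnit] at h4
  have h5 : invSubst π (monomial m (p.coeff m)) =
      algebraMap (MvPolynomial (Fin n) K) (TorusRing K n) (C (p.coeff m)) *
      ∏ i, (((coordUnit K n (π i))⁻¹ : (TorusRing K n)ˣ) : TorusRing K n) ^ m i := by
    rw [monomial_eq, Finsupp.prod_fintype _ _ (by simp), map_mul, invSubst_C, map_prod]
    congr 1
    exact Finset.prod_congr rfl fun i _ ↦ by rw [map_pow, invSubst_X]
  rw [val_mk_eq, h5, ← h4, map_mul, map_mul, map_pow, ← coe_prod_coordUnit, map_prod]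
  simp only [map_pow, Units.val_pow_eq_pow_val]
  ring

lemma exists_val_eq_cremona (π : Equiv.Perm (Fin n)) (a : ProjTorusRing K n) :
    ∃ b : ProjTorusRing K n, b.val = cremona π a.val := by
  obtain ⟨k, p, hp, rfl⟩ := Away.mk_surjective _ (coordProd_mem K n) a
  obtain ⟨b, hb⟩ := exists_val_eq_invSubst π k p hp
  refine ⟨b, hb.trans ?_⟩
  rw [val_mk_eq, map_mul, cremona_algebraMap]
  congr 1
  exact (cremona_prod_coordUnit_pow π k).symm

/-- The restriction of the Cremona transformation to the elements of degree zero. -/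
noncomputable def projCremonaHom (π : Equiv.Perm (Fin n)) :
    ProjTorusRing K n →+* ProjTorusRing K n where
  -- The choice is forced, as `val` is injective; for the same reason the ring axioms can be checked
  -- on the affine torus.
  toFun a := (exists_val_eq_cremona π a).choose
  map_one' := val_injective _ (by
    rw [(exists_val_eq_cremona π 1).choose_spec, val_one, map_one])
  map_mul' a b := val_injective _ (by
    rw [(exists_val_eq_cremona π (a * b)).choose_spec, val_mul, val_mul, map_mul,
      (exists_val_eq_cremona π a).choose_spec, (exists_val_eq_cremona π b).choose_spec])
  map_zero' := val_injective _ (by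
    rw [(exists_val_eq_cremona π 0).choose_spec, val_zero, map_zero])
  map_add' a b := val_injective _ (by
    rw [(exists_val_eq_cremona π (a + b)).choose_spec, val_add, val_add, map_add,
      (exists_val_eq_cremona π a).choose_spec, (exists_val_eq_cremona π b).choose_spec])

lemma val_projCremonaHom (π : Equiv.Perm (Fin n)) (a : ProjTorusRing K n) :
    (projCremonaHom π a).val = cremona π a.val := (exists_val_eq_cremona π a).choose_spec

lemma projCremonaHom_comp_symm (π : Equiv.Perm (Fin n)) :
    (projCremonaHom (K := K) π.symm).comp (projCremonaHom π) = RingHom.id _ := by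
  ext a
  simp only [RingHom.comp_apply, val_projCremonaHom, RingHom.id_apply]
  exact congrArg (fun φ : TorusRing K n →+* TorusRing K n ↦ φ a.val) (cremona_comp_cremona_symm π)

/-- The Cremona transformation of the torus in projective space, composed with a permutation of
the coordinates. -/
noncomputable def projCremona (π : Equiv.Perm (Fin n)) : ProjTorusRing K n ≃+* ProjTorusRing K n :=
  RingEquiv.ofRingHom (projCremonaHom π) (projCremonaHom π.symm)
    (projCremonaHom_comp_symm π.symm) (projCremonaHom_comp_symm π)

lemma val_projCremona (π : Equiv.Perm (Fin n)) (a : ProjTorusRing K n) :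
    (projCremona π a).val = cremona π a.val := val_projCremonaHom π a

lemma projCremona_algebraMap (π : Equiv.Perm (Fin n)) (c : K) :
    projCremona π (fromZeroRingHom (homogeneousSubmodule (Fin n) K) _
      (algebraMap K (homogeneousSubmodule (Fin n) K 0) c)) =
    fromZeroRingHom (homogeneousSubmodule (Fin n) K) _
      (algebraMap K (homogeneousSubmodule (Fin n) K 0) c) := by
  have h : ∀ c, (fromZeroRingHom (homogeneousSubmodule (Fin n) K)
      (Submonoid.powers (coordProd K n)) (algebraMap K (homogeneousSubmodule (Fin n) K 0) c)).val =
      algebraMap (MvPolynomial (Fin n) K) _ (C c) := fun c ↦ by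
    change Localization.mk _ _ = _
    exact Localization.mk_one_eq_algebraMap _
  apply val_injective
  rw [val_projCremona, h, cremona_algebraMap]
  exact invSubst_C π c

/-- The function on the torus in projective space that describes the zero locus of a homogeneous
polynomial. -/
noncomputable def torusElem (d : ℕ) (p : MvPolynomial (Fin n) K)
    (hp : p ∈ homogeneousSubmodule (Fin n) K d) : ProjTorusRing K n :=
  Away.isLocalizationElem (coordProd_mem K n) (SetLike.mul_mem_graded hp (coordProd_mem K n))

/-- With `c` the coordinate product, the defining fraction is `(p * c) ^ n / c ^ (d + n)`; the
factor `c`, a unit on the torus, keeps the degree positive even for `d = 0`. -/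
lemma val_torusElem (d : ℕ) (p : MvPolynomial (Fin n) K)
    (hp : p ∈ homogeneousSubmodule (Fin n) K d) :
    (torusElem d p hp).val = algebraMap _ (TorusRing K n) p ^ n *
      (((∏ i, coordUnit K n i)⁻¹ ^ d : (TorusRing K n)ˣ) : TorusRing K n) := by
  rw [torusElem, val_mk_eq, map_pow, map_mul, ← coe_prod_coordUnit, mul_pow, mul_assoc,
    ← Units.val_pow_eq_pow_val, ← Units.val_mul]
  congr 2
  rw [pow_add, mul_left_comm, ← mul_pow, mul_inv_cancel, one_pow, mul_one]

/-- With `u` the coordinate product and `p'` the substituted `p`, both sides equal `p' ^ n * u ^ d`,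
because `n - d' = d`. -/
lemma projCremona_torusElem (π : Equiv.Perm (Fin n)) {d d' : ℕ} (hd : d + d' = n)
    {p q : MvPolynomial (Fin n) K} (hp : p ∈ homogeneousSubmodule (Fin n) K d)
    (hq : q ∈ homogeneousSubmodule (Fin n) K d')
    (hpq : algebraMap _ (TorusRing K n) q = invSubst π p *
      ((∏ i, coordUnit K n i : (TorusRing K n)ˣ) : TorusRing K n)) :
    projCremona π (torusElem d p hp) = torusElem d' q hq := by
  apply val_injective
  rw [val_projCremona, val_torusElem, val_torusElem, hpq, map_mul, map_pow, cremona_algebraMap,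
    cremona_prod_coordUnit_pow, mul_pow, mul_assoc, ← Units.val_pow_eq_pow_val, ← Units.val_mul]
  congr 2
  rw [← hd, pow_add, mul_assoc, ← mul_pow, mul_inv_cancel, one_pow, mul_one]

end ProjSpace

/-!
### Kirchhoff polynomials of dual graphs
-/

namespace Graph

open MvPolynomial ProjSpace

variable {α β α' β' : Type*}

/-- The set of edges with numbers in `T`. -/
def edgesOf (G : Graph α β) {n : ℕ} (ε : G.edgeSet ≃ Fin n) (T : Finset (Fin n)) : Set β :=
  {e | ∃ h : e ∈ G.edgeSet, ε ⟨e, h⟩ ∈ T}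

-- Sorting the monomials by degree makes it unnecessary to know that all spanning trees have equally
-- many edges.
open scoped Classical in
lemma homogeneousComponent_kirchhoffPolynomial (K : Type*) [Field K] (G : Graph α β) {n : ℕ}
    (ε : G.edgeSet ≃ Fin n) (d : ℕ) :
    homogeneousComponent d (G.kirchhoffPolynomial K ε) =
      ∑ T : Finset (Fin n) with G.IsSpanningTree (G.edgesOf ε T) ∧ Tᶜ.card = d,
        ∏ i ∈ Tᶜ, X i := by
  rw [kirchhoffPolynomial, map_sum, ← Finset.filter_filter]
  refine (Finset.sum_congr rfl fun T _ ↦ ?_).trans (Finset.sum_filter _ _).symm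
  have h : (∏ i ∈ Tᶜ, X i : MvPolynomial (Fin n) K) ∈ homogeneousSubmodule (Fin n) K Tᶜ.card := by
    have := IsHomogeneous.prod Tᶜ (fun i : Fin n ↦ (X i : MvPolynomial (Fin n) K)) (fun _ ↦ 1)
      (fun i _ ↦ isHomogeneous_X K i)
    simpa using this
  rw [homogeneousComponent_of_mem h]
  simp only [eq_comm]

namespace SphereEmbedding.DualData

variable {G : Graph α β} {f : G.SphereEmbedding} {G' : Graph α' β'} (D : f.DualData G')
  {n : ℕ} (ε : G.edgeSet ≃ Fin n) (ε' : G'.edgeSet ≃ Fin n)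

/-- The permutation of the edge numbers that corresponds to a duality. -/
noncomputable def edgePerm : Equiv.Perm (Fin n) :=
  (ε.symm.trans (Set.BijOn.equiv D.dualEdge D.dualEdge_bijOn)).trans ε'

lemma edgesOf_map_edgePerm_compl (T : Finset (Fin n)) :
    G'.edgesOf ε' (Tᶜ.map (D.edgePerm ε ε').toEmbedding) =
      D.dualEdge '' (G.edgeSet \ G.edgesOf ε T) := by
  ext e'
  constructor
  · rintro ⟨h, hT⟩
    obtain ⟨i, hi, hi'⟩ := Finset.mem_map.1 hT
    have h1 := congrArg Subtype.val (ε'.injective hi')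
    refine ⟨ε.symm i, ⟨(ε.symm i).2, fun ⟨h2, h3⟩ ↦ ?_⟩, h1⟩
    rw [Subtype.coe_eta, Equiv.apply_symm_apply] at h3
    exact Finset.mem_compl.1 hi h3
  · rintro ⟨e, ⟨he, heT⟩, rfl⟩
    refine ⟨D.dualEdge_bijOn.mapsTo he, Finset.mem_map.2 ⟨ε ⟨e, he⟩, ?_, ?_⟩⟩
    · exact Finset.mem_compl.2 fun h ↦ heT ⟨he, h⟩
    · simp only [edgePerm, Equiv.coe_toEmbedding, Equiv.trans_apply, Equiv.symm_apply_apply]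
      rfl

lemma isSpanningTree_map_edgePerm_compl_iff (hG : G.IsConnected) (hn : 0 < n)
    (T : Finset (Fin n)) :
    G'.IsSpanningTree (G'.edgesOf ε' (Tᶜ.map (D.edgePerm ε ε').toEmbedding)) ↔
      G.IsSpanningTree (G.edgesOf ε T) := by
  have hE : G.edgeSet.Finite := Set.finite_coe_iff.1 (Finite.of_equiv _ ε.symm)
  -- As `n` is positive, the dual graph has an edge and hence a vertex.
  have hne : G'.vertexSet.Nonempty := by
    obtain ⟨x, y, h⟩ := exists_isLink_of_mem_edgeSet (ε'.symm ⟨0, hn⟩).2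
    exact ⟨x, h.left_mem⟩
  have h1 : G.edgesOf ε T ⊆ G.edgeSet := fun e he ↦ he.1
  rw [IsSpanningTree, IsSpanningTree, D.isTree_dual_iff hG hE hne h1,
    ← D.edgesOf_map_edgePerm_compl ε ε' T]
  exact and_congr_left fun _ ↦ ⟨fun _ ↦ h1, fun _ e he ↦ he.1⟩

/-- Term by term: inverting the variables outside `T` and multiplying by all variables leaves those
of `T`, which is the monomial of the dual tree. Its degree is `T.card = n - Tᶜ.card`. -/
lemma algebraMap_homogeneousComponent_dual (K : Type*) [Field K] (hG : G.IsConnected)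
    (hn : 0 < n) {d d' : ℕ} (hd : d + d' = n) :
    algebraMap _ (TorusRing K n) (homogeneousComponent d' (G'.kirchhoffPolynomial K ε')) =
      invSubst (D.edgePerm ε ε') (homogeneousComponent d (G.kirchhoffPolynomial K ε)) *
        ((∏ i, coordUnit K n i : (TorusRing K n)ˣ) : TorusRing K n) := by
  classical
  set π := D.edgePerm ε ε' with hπ
  rw [homogeneousComponent_kirchhoffPolynomial, homogeneousComponent_kirchhoffPolynomial, map_sum,
    map_sum, Finset.sum_mul]
  symm
  refine Finset.sum_equiv ((Function.Involutive.toPerm _ compl_involutive).trans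
    (Equiv.finsetCongr π)) (fun T ↦ ?_) fun T _ ↦ ?_
  · simp only [Finset.mem_filter, Finset.mem_univ, true_and, Equiv.trans_apply,
      Function.Involutive.coe_toPerm, Equiv.finsetCongr_apply]
    rw [D.isSpanningTree_map_edgePerm_compl_iff ε ε' hG hn]
    refine and_congr_right fun _ ↦ ?_
    have h1 := T.card_add_card_compl
    have h2 := (Tᶜ.map π.toEmbedding).card_add_card_compl
    rw [Finset.card_map] at h2
    simp only [Fintype.card_fin] at h1 h2
    omega
  · have h1 : (Tᶜ.map π.toEmbedding)ᶜ = T.map π.toEmbedding := by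
      ext i
      simp [Finset.mem_map_equiv]
    simp only [Equiv.trans_apply, Function.Involutive.coe_toPerm, Equiv.finsetCongr_apply, h1,
      map_prod, Finset.prod_map, invSubst_X, Equiv.coe_toEmbedding]
    have h2 : ((∏ i ∈ Tᶜ, (coordUnit K n (π i))⁻¹) * ∏ i, coordUnit K n i : (TorusRing K n)ˣ) =
        ∏ i ∈ T, coordUnit K n (π i) := by
      rw [← Equiv.prod_comp π (coordUnit K n), ← Finset.prod_compl_mul_prod T, ← mul_assoc,
        ← Finset.prod_mul_distrib]
      simp
    have h3 := congrArg Units.val h2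
    simpa only [Units.val_mul, Units.coe_prod, coe_coordUnit] using h3

end SphereEmbedding.DualData

end Graph

/-!
### The torus part of a closed subvariety of projective space
-/

namespace AlgebraicGeometry

open CategoryTheory Scheme

universe v

/-- The kernel is the image of the zero ideal, which on a reduced scheme is the vanishing ideal of
the whole space. -/
lemma ker_eq_vanishingIdeal {X Y : Scheme.{v}} [IsReduced X] (i : X ⟶ Y) [IsClosedImmersion i] :
    i.ker = IdealSheafData.vanishingIdeal ⟨Set.range i, i.isClosedEmbedding.isClosed_range⟩ := by
  rw [← IdealSheafData.map_bot, ← nilradical_eq_bot, ← IdealSheafData.vanishingIdeal_top,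
    IdealSheafData.map_vanishingIdeal]
  congr 1
  ext1
  simp [i.isClosedEmbedding.isClosed_range.closure_eq]

/-- A reduced closed subscheme is determined by its points. -/
lemma exists_iso_of_range_eq {X X' Y : Scheme.{v}} [IsReduced X] [IsReduced X'] (i : X ⟶ Y)
    (i' : X' ⟶ Y) [IsClosedImmersion i] [IsClosedImmersion i'] (h : Set.range i = Set.range i') :
    ∃ e : X ≅ X', e.hom ≫ i' = i := by
  have hker : i'.ker = i.ker := by
    rw [ker_eq_vanishingIdeal, ker_eq_vanishingIdeal]
    simp only [h]
  have := IsClosedImmersion.isIso_lift i' i hker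
  exact ⟨asIso (IsClosedImmersion.lift i' i hker.le), IsClosedImmersion.lift_fac _ _ _⟩

end AlgebraicGeometry

namespace ProjSpace

open CategoryTheory CategoryTheory.Limits AlgebraicGeometry TopologicalSpace MvPolynomial Scheme

attribute [local instance] MvPolynomial.gradedAlgebra

universe v

variable (K : Type v) [Field K] {n : ℕ} (hn : 0 < n)

/-- The torus in projective space. -/
noncomputable def torusι : Spec (.of (ProjTorusRing K n)) ⟶ space K n :=
  Proj.awayι _ (coordProd K n) (coordProd_mem K n) hn

instance : IsOpenImmersion (torusι K hn) := by
  unfold torusι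
  infer_instance

lemma range_torusι : Set.range (torusι K hn) = (simplex K n : Set (space K n))ᶜ := by
  have h := Proj.opensRange_awayι _ (coordProd K n) (coordProd_mem K n) hn
  have h1 := congrArg (fun U : (space K n).Opens ↦ (U : Set (space K n))) h
  refine h1.trans ?_
  ext x
  exact not_congr Set.singleton_subset_iff.symm

lemma torusι_toSpec : torusι K hn ≫ toSpec K n =
    Spec.map (CommRingCat.ofHom ((HomogeneousLocalization.fromZeroRingHom
      (homogeneousSubmodule (Fin n) K) (Submonoid.powers (coordProd K n))).comp
        (algebraMap K (homogeneousSubmodule (Fin n) K 0)))) := by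
  rw [torusι, toSpec, Proj.awayι_toSpecZero_assoc, ← Spec.map_comp]
  rfl

/-- The part of a closed subvariety of projective space in the torus. -/
noncomputable abbrev torusPartScheme (Z : Closeds (space K n)) : Scheme :=
  pullback (IdealSheafData.vanishingIdeal Z).subschemeι (torusι K hn)

instance (Z : Closeds (space K n)) : IsReduced (torusPartScheme K hn Z) :=
  have := isReduced_subscheme Z
  isReduced_of_isOpenImmersion (pullback.fst _ _ :
    torusPartScheme K hn Z ⟶ (IdealSheafData.vanishingIdeal Z).subscheme)

/-- The part of a closed subvariety of projective space in the torus, as a variety. -/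
noncomputable def torusPart (Z : Closeds (space K n)) : AlgVariety K where
  toOver := Over.mk ((pullback.snd _ _ : torusPartScheme K hn Z ⟶ _) ≫ torusι K hn ≫ toSpec K n)
  isReduced := by dsimp; infer_instance
  isSeparated := by dsimp; infer_instance
  locallyOfFiniteType := by dsimp; infer_instance
  quasiCompact := by dsimp; rw [torusι_toSpec]; infer_instance

lemma range_snd_torusPart (Z : Closeds (space K n)) :
    Set.range (pullback.snd _ _ : torusPartScheme K hn Z ⟶ _) = torusι K hn ⁻¹' Z := by
  rw [Pullback.range_snd, IdealSheafData.range_subschemeι,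
    IdealSheafData.coe_support_vanishingIdeal]

/-- The scissor relation for the part of `Z` on the simplex, whose open complement in `Z` is the
torus part. -/
lemma cls_closedSubvariety (Z : Closeds (space K n)) :
    (closedSubvariety K n Z).cls =
      (closedSubvariety K n (simplex K n ⊓ Z)).cls + (torusPart K hn Z).cls := by
  have hle : IdealSheafData.vanishingIdeal Z ≤ IdealSheafData.vanishingIdeal (simplex K n ⊓ Z) :=
    IdealSheafData.vanishingIdeal_antimono inf_le_right
  let i : (closedSubvariety K n (simplex K n ⊓ Z)).toOver ⟶ (closedSubvariety K n Z).toOver :=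
    Over.homMk (IdealSheafData.inclusion hle) (by simp [closedSubvariety])
  let j : (torusPart K hn Z).toOver ⟶ (closedSubvariety K n Z).toOver :=
    Over.homMk (pullback.fst _ _) (by
      simp only [closedSubvariety, torusPart, Over.mk_hom]
      rw [pullback.condition_assoc])
  have hi : IsClosedImmersion (IdealSheafData.inclusion hle) := by
    have : IsClosedImmersion (IdealSheafData.inclusion hle ≫
      (IdealSheafData.vanishingIdeal Z).subschemeι) := by
      rw [IdealSheafData.inclusion_subschemeι]
      infer_instance
    exact IsClosedImmersion.of_comp_isClosedImmersion _
      (IdealSheafData.vanishingIdeal Z).subschemeι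
  have hj : IsOpenImmersion (pullback.fst (IdealSheafData.vanishingIdeal Z).subschemeι
      (torusι K hn)) := inferInstance
  have hij : Set.range (pullback.fst (IdealSheafData.vanishingIdeal Z).subschemeι
      (torusι K hn)) = (Set.range (IdealSheafData.inclusion hle))ᶜ := by
    have h1 : (IdealSheafData.vanishingIdeal Z).subschemeι ⁻¹' (simplex K n) =
        Set.range (IdealSheafData.inclusion hle) := by
      have hinj : Function.Injective (IdealSheafData.vanishingIdeal Z).subschemeι :=
        (IdealSheafData.vanishingIdeal Z).subschemeι.isClosedEmbedding.injective
      apply hinj.image_injective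
      rw [Set.image_preimage_eq_range_inter, ← Set.range_comp]
      have h2 := IdealSheafData.range_subschemeι
        (IdealSheafData.vanishingIdeal (simplex K n ⊓ Z))
      rw [← IdealSheafData.inclusion_subschemeι hle] at h2
      rw [IdealSheafData.range_subschemeι, IdealSheafData.coe_support_vanishingIdeal]
      rw [IdealSheafData.coe_support_vanishingIdeal] at h2
      exact (Set.inter_comm _ _).trans h2.symm
    rw [Pullback.range_fst, range_torusι, Set.preimage_compl, h1]
  have h := GrothendieckRing.Relation.scissor _ _ _ i j hi hj hij
  have h1 := Ideal.Quotient.eq_zero_iff_mem.2 (Ideal.subset_span h :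
    _ ∈ Ideal.span {r | GrothendieckRing.Relation K r})
  rw [map_sub, map_add, sub_eq_zero] at h1
  exact h1

/-! ### Hypersurfaces on the torus and their comparison -/

variable {K}

/-- The element cuts out the locus of `p * coordProd K n`, and on the torus the second factor lies
in no prime. -/
lemma torusι_mem_hypersurface_iff_of_mem {d : ℕ} {p : MvPolynomial (Fin n) K}
    (hp : p ∈ homogeneousSubmodule (Fin n) K d) (x : PrimeSpectrum (ProjTorusRing K n)) :
    torusι K hn x ∈ hypersurface K n p ↔ torusElem d p hp ∈ x.asIdeal := by
  have h := Proj.awayι_preimage_basicOpen _ (coordProd_mem K n) hn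
    (SetLike.mul_mem_graded hp (coordProd_mem K n)) (Nat.add_pos_right d hn)
  have h1 : p * coordProd K n ∉ (torusι K hn x).asHomogeneousIdeal ↔
      torusElem d p hp ∉ x.asIdeal :=
    iff_of_eq (congrArg (fun U : (Spec (.of (ProjTorusRing K n))).Opens ↦ x ∈ U) h)
  rw [← not_iff_not.1 h1]
  have hx : torusι K hn x ∈ (simplex K n : Set (space K n))ᶜ :=
    range_torusι K hn ▸ Set.mem_range_self x
  have hx' : coordProd K n ∉ (torusι K hn x).asHomogeneousIdeal := fun h ↦
    hx (Set.singleton_subset_iff.2 h)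
  refine Set.singleton_subset_iff.trans ⟨fun h ↦ Ideal.mul_mem_right _ _ h, fun h ↦ ?_⟩
  exact ((torusι K hn x).isPrime.mem_or_mem h).resolve_right hx'

lemma torusι_mem_hypersurface_iff (p : MvPolynomial (Fin n) K)
    (x : PrimeSpectrum (ProjTorusRing K n)) :
    torusι K hn x ∈ hypersurface K n p ↔
      ∀ d, torusElem d (homogeneousComponent d p) (homogeneousComponent_mem d p) ∈ x.asIdeal := by
  simp only [← torusι_mem_hypersurface_iff_of_mem hn]
  have h1 : ∀ q : MvPolynomial (Fin n) K, torusι K hn x ∈ hypersurface K n q ↔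
      q ∈ (torusι K hn x).asHomogeneousIdeal.toIdeal := fun q ↦ Set.singleton_subset_iff
  simp only [h1]
  exact mem_iff_homogeneousComponent_mem (torusι K hn x).asHomogeneousIdeal.isHomogeneous p

/-- Both torus parts are reduced closed subschemes of the torus, so it is enough that the
automorphism matches their points; `hτK` makes the resulting isomorphism one over `K`. -/
lemma cls_torusPart_eq_of_ringEquiv {Z Z' : Closeds (space K n)}
    (τ : ProjTorusRing K n ≃+* ProjTorusRing K n)
    (hτK : ∀ c, τ (HomogeneousLocalization.fromZeroRingHom (homogeneousSubmodule (Fin n) K) _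
        (algebraMap K (homogeneousSubmodule (Fin n) K 0) c)) =
      HomogeneousLocalization.fromZeroRingHom (homogeneousSubmodule (Fin n) K) _
        (algebraMap K (homogeneousSubmodule (Fin n) K 0) c))
    (hτ : ∀ x : PrimeSpectrum (ProjTorusRing K n),
      torusι K hn (PrimeSpectrum.comap τ.toRingHom x) ∈ Z ↔ torusι K hn x ∈ Z') :
    (torusPart K hn Z).cls = (torusPart K hn Z').cls := by
  let s : Spec (.of (ProjTorusRing K n)) ≅ Spec (.of (ProjTorusRing K n)) :=
    Scheme.Spec.mapIso τ.toCommRingCatIso.op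
  have hs : s.hom = Spec.map (CommRingCat.ofHom τ.toRingHom) := rfl
  have hsK : s.hom ≫ torusι K hn ≫ toSpec K n = torusι K hn ≫ toSpec K n := by
    rw [torusι_toSpec, hs, ← Spec.map_comp, ← CommRingCat.ofHom_comp]
    congr 2
    ext c : 1
    exact hτK c
  have hrange : Set.range ((pullback.snd _ _ : torusPartScheme K hn Z' ⟶ _) ≫ s.hom) =
      Set.range (pullback.snd _ _ : torusPartScheme K hn Z ⟶ _) := by
    have h1 : torusι K hn ⁻¹' Z' = s.hom ⁻¹' (torusι K hn ⁻¹' Z) :=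
      Set.ext fun x ↦ (hτ x).symm
    have hsurj : Function.Surjective s.hom := s.hom.homeomorph.surjective
    have h2 := Set.range_comp s.hom (pullback.snd _ _ : torusPartScheme K hn Z' ⟶ _)
    rw [range_snd_torusPart, h1, Set.image_preimage_eq _ hsurj] at h2
    rw [range_snd_torusPart]
    exact h2
  obtain ⟨e, he⟩ := exists_iso_of_range_eq
    ((pullback.snd _ _ : torusPartScheme K hn Z' ⟶ _) ≫ s.hom)
    (pullback.snd _ _ : torusPartScheme K hn Z ⟶ _) hrange
  let φ : (torusPart K hn Z').toOver ≅ (torusPart K hn Z).toOver := Over.isoMk e (by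
    change e.hom ≫ pullback.snd _ _ ≫ torusι K hn ≫ toSpec K n =
      pullback.snd _ _ ≫ torusι K hn ≫ toSpec K n
    rw [← Category.assoc e.hom, he, Category.assoc, hsK])
  have h1 := Ideal.Quotient.eq_zero_iff_mem.2 (Ideal.subset_span
    (GrothendieckRing.Relation.iso _ _ φ) : _ ∈ Ideal.span {r | GrothendieckRing.Relation K r})
  rw [map_sub, sub_eq_zero] at h1
  exact h1.symm

lemma torusElem_zero (hn : 0 < n) (d : ℕ) : torusElem d (0 : MvPolynomial (Fin n) K) (Submodule.zero_mem _) =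
    0 := by
  apply HomogeneousLocalization.val_injective
  rw [val_torusElem, map_zero, zero_pow hn.ne', zero_mul, HomogeneousLocalization.val_zero]

lemma torusElem_kirchhoffPolynomial_eq_zero (hn : 0 < n) {α β : Type*} (G : Graph α β)
    (ε : G.edgeSet ≃ Fin n) {d : ℕ} (hd : n < d) :
    torusElem d (homogeneousComponent d (G.kirchhoffPolynomial K ε))
      (homogeneousComponent_mem d _) = 0 := by
  have h : homogeneousComponent d (G.kirchhoffPolynomial K ε) = 0 := by
    classical
    rw [Graph.homogeneousComponent_kirchhoffPolynomial, Finset.filter_eq_empty_iff.2,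
      Finset.sum_empty]
    rintro T - ⟨-, hT⟩
    have := Tᶜ.card_le_univ
    rw [Fintype.card_fin] at this
    omega
  simp only [h, torusElem_zero hn]

lemma cls_torusPart_eq_of_dualData {α β α' β' : Type*} {Γ : Graph α β} (hΓ : Γ.IsConnected)
    {f : Γ.SphereEmbedding} {Γ' : Graph α' β'} (D : f.DualData Γ') (ε : Γ.edgeSet ≃ Fin n)
    (ε' : Γ'.edgeSet ≃ Fin n) :
    (torusPart K hn (Γ.hypersurface K ε)).cls = (torusPart K hn (Γ'.hypersurface K ε')).cls := by
  refine cls_torusPart_eq_of_ringEquiv hn (projCremona (D.edgePerm ε ε'))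
    (projCremona_algebraMap _) fun x ↦ ?_
  rw [Graph.hypersurface, Graph.hypersurface, torusι_mem_hypersurface_iff,
    torusι_mem_hypersurface_iff]
  have key (d d' : ℕ) (hd : d + d' = n) :
      torusElem d (homogeneousComponent d (Γ.kirchhoffPolynomial K ε))
          (homogeneousComponent_mem d _) ∈
          (PrimeSpectrum.comap (projCremona (D.edgePerm ε ε')).toRingHom x).asIdeal ↔
        torusElem d' (homogeneousComponent d' (Γ'.kirchhoffPolynomial K ε'))
          (homogeneousComponent_mem d' _) ∈ x.asIdeal := by
    rw [← projCremona_torusElem (D.edgePerm ε ε') hd (homogeneousComponent_mem d _)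
      (homogeneousComponent_mem d' _) (D.algebraMap_homogeneousComponent_dual ε ε' K hΓ hn hd)]
    rfl
  -- Degrees up to `n` are paired by `d + d' = n`; in higher degrees the components vanish.
  refine ⟨fun h d' ↦ ?_, fun h d ↦ ?_⟩
  · obtain hd | hd := le_or_gt d' n
    · obtain ⟨d, hd⟩ := Nat.exists_eq_add_of_le' hd
      exact (key d d' hd.symm).1 (h d)
    · rw [torusElem_kirchhoffPolynomial_eq_zero hn Γ' ε' hd]
      exact zero_mem _
  · obtain hd | hd := le_or_gt d n
    · obtain ⟨d', hd⟩ := Nat.exists_eq_add_of_le hd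
      exact (key d d' hd.symm).2 (h d')
    · rw [torusElem_kirchhoffPolynomial_eq_zero hn Γ ε hd]
      exact zero_mem _

/-- Without coordinates every polynomial is constant, so the irrelevant ideal is zero and lies in
every prime. -/
instance : IsEmpty (space K 0) := by
  refine ⟨fun x ↦ x.not_irrelevant_le fun p hp ↦ ?_⟩
  have h : p = 0 := by
    obtain ⟨c, rfl⟩ := C_surjective (Fin 0) p
    have h1 : GradedRing.proj (homogeneousSubmodule (Fin 0) K) 0 (C c) = 0 := hp
    rw [GradedRing.proj_apply, DirectSum.decompose_of_mem_same _
      ((mem_homogeneousSubmodule _ _).2 (isHomogeneous_C _ c))] at h1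
    exact h1
  rw [h]
  exact zero_mem _

end ProjSpace

theorem mainTheorem10 {α β α' β' : Type*} (K : Type u) [Field K]
    (Γ : Graph α β) (hΓ : Γ.IsConnected) (f : Γ.SphereEmbedding)
    (Γ' : Graph α' β') (hdual : f.IsDual Γ')
    {n : ℕ} (ε : Γ.edgeSet ≃ Fin n) (ε' : Γ'.edgeSet ≃ Fin n) :
    (ProjSpace.closedSubvariety K n (Γ.hypersurface K ε)).cls
        - (ProjSpace.closedSubvariety K n (Γ'.hypersurface K ε')).cls
      = (ProjSpace.closedSubvariety K n (ProjSpace.simplex K n ⊓ Γ.hypersurface K ε)).cls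
        - (ProjSpace.closedSubvariety K n (ProjSpace.simplex K n ⊓ Γ'.hypersurface K ε')).cls := by
  obtain ⟨region, dualEdge, h1, h2, h3⟩ := hdual
  obtain rfl | hn := Nat.eq_zero_or_pos n
  -- Without edges the ambient projective space is empty, so the two closed subsets coincide.
  · have h : Γ.hypersurface K ε = Γ'.hypersurface K ε' :=
      SetLike.coe_injective (Subsingleton.elim _ _)
    rw [h, sub_self, sub_self]
  · rw [ProjSpace.cls_closedSubvariety K hn (Γ.hypersurface K ε),
      ProjSpace.cls_closedSubvariety K hn (Γ'.hypersurface K ε'),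
      ProjSpace.cls_torusPart_eq_of_dualData hn hΓ ⟨region, dualEdge, h1, h2, h3⟩ ε ε',
      add_sub_add_right_eq_sub]
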